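/- **Setting.** Let $\Lambda=\mathcal K\mathcal Q/\langle\rho\rangle$ be a string algebra: $\mathcal Q=(Q_0,Q_1,s,t)$ is a finite quiver, $\rho$ is a finite set of paths generating an admissible ideal, at most two arrows start and at most two arrows end at each vertex, and for each arrow $b$ there is at most one arrow $a$ such that $ab$ is a path not in $\rho$ and at most one arrow $c$ such that $bc$ is a path not in $\rho$ (paths are read from right to left: $ab$ is a path iff $s(a)=t(b)$). Fix maps $\sigma,\tau:Q_1\to\{1,-1\}$ such that for all arrows $a\neq b$: $\sigma(a)=-\sigma(b)$ if $s(a)=s(b)$; $\tau(a)=-\tau(b)$ if $t(a)=t(b)$; and $\sigma(a)=-\tau(b)$ if $s(a)=t(b)$ and $ab\notin\rho$. Syllables are arrows (direct) and formal inverses $a^-$ of arrows (inverse), with $s(a^-)=t(a)$, $t(a^-)=s(a)$, $\sigma(a^-)=\tau(a)$, $\tau(a^-)=\sigma(a)$. A string is either a zero-length string $1_{(v,i)}$ with $v\in Q_0$, $i\in\{1,-1\}$, or a word $\alpha_1\cdots\alpha_n$ ($n\ge1$) in the syllables with $s(\alpha_j)=t(\alpha_{j+1})$ and $\alpha_j\ne\alpha_{j+1}^-$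 for all $j<n$, such that no subword, nor the inverse of a subword, lies in $\rho$. Put $s(\alpha_1\cdots\alpha_n)=s(\alpha_n)$, $\sigma(\alpha_1\cdots\alpha_n)=\sigma(\alpha_n)$, $t(\alpha_1\cdots\alpha_n)=t(\alpha_1)$, $\tau(\alpha_1\cdots\alpha_n)=\tau(\alpha_1)$; $s(1_{(v,i)})=t(1_{(v,i)})=v$, $\tau(1_{(v,i)})=i=-\sigma(1_{(v,i)})$. Inverses are $1_{(v,i)}^-=1_{(v,-i)}$, $(\alpha_1\cdots\alpha_n)^-=\alpha_n^-\cdots\alpha_1^-$. The product $1_{(v,i)}x$ is defined (and equal to $x$) iff $t(x)=v$ and $\tau(x)=i$; $x1_{(v,i)}$ is defined (and equal to $x$) iff $s(x)=v$ and $\sigma(x)=-i$; other products are concatenations of words. For $v\in Q_0$ let $H(v)$ be the set of pairs $(x_1,x_2)$ of strings such that $x_1 1_{(v,1)}$ and $1_{(v,1)}x_2$ are defined and $x_1x_2$ is a string, and let $H_l(v)$ and $H_r(v)$ be its left and right projections. For distinct $x,y\in H_l(v)$ put $x<_l y$ iff, for the longest $w$ with $x=x'w$ and $y=y'w$, either $x'$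 has a direct rightmost syllable or $y'$ has an inverse rightmost syllable. For $x,y\in H_r(v)$ put $x<_r y$ iff $x^-<_l y^-$. The class of *finite description linear orders* is the smallest class of linear orders that contains $\mathbf 0$ and $\mathbf 1$ and is closed under order isomorphisms, binary sums, multiplication by $\omega$, multiplication by $\omega^*$, and finitary shuffles $\Xi(L_0,\dots,L_{n-1})=\sum_{q\in\mathbb Q}L_{\chi(q)}$, where $\chi:\mathbb Q\to\{0,\dots,n-1\}$ has all colour classes dense in $\mathbb Q$. (It contains all finite orders and is closed under products and reversal.) *Automata.* For a finite automaton $M$ over $\{0,1\}$ with partial transition function $\delta$, its *linguage* is its language ordered by the inorder: for distinct words, $x<y$ iff for the longest $w$ with $x=wx'$, $y=wy'$, either $x'$ begins with $0$ or $y'$ begins with $1$. The *word problem* $W_M$ has the states as unknowns and the equations $q=\delta(q,0)\,b_q\,\delta(q,1)$, where undefined transitions are read as the empty word and $b_q=\star$ if $q$ is accepting, $b_q$ empty otherwise. An arrangement is a linear order coloured by letters; a solution of a word problem is a family of arrangements $A_q$ with colour-preserving isomorphisms from $A_q$ to the concatenation of arrangements obtained by substituting $A$ in the right-hand side; morphisms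 of solutions are families of colour-preserving order embeddings compatible with these isomorphisms; a *universal solution* is an initial object. Let $r$ be the length of the longest element of $\rho$ ($r=2$ if $\rho=\emptyset$). A string is *short* if its length is less than $r$; for a string $x$ let $[x]$ be its longest short left factor. Let $M'_\Lambda(v)$ be the automaton whose states are the short strings, all accepting, with start state $1_{(v,1)}$, and with $\delta(x,c)=[\beta x]$ if there is a syllable $\beta$, direct if $c=0$ and inverse if $c=1$, such that $\beta x$ is a string, and $\delta(x,c)$ undefined otherwise. For $x\in H_l(v)$ let $\mathrm{sgn}(x)$ be the binary word obtained by reading the syllables of $x$ from right to left, writing $0$ for direct and $1$ for inverse ones. **Theorem.** For every vertex $v$ of $\mathcal Q$: 1. $(H_l(v),<_l)$ and $(H_r(v),<_r)$ are linear orders, and both are finite description linear orders. 2. $\mathrm{sgn}$ is an order isomorphism from $(H_l(v),<_l)$ onto the linguage of $M'_\Lambda(v)$. 3. The word problem $W_{M'_\Lambda(v)}$ has a universal solution. In any universal solution, the linear order underlying the component at the start state is isomorphic to the linguage of $M'_\Lambda(v)$ (hence to $H_l(v)$), and the linear order underlying every component is a finite description linear order. -/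

import Mathlib

universe u

/-! ## Finite description linear orders

A linear order on a type is given by its strict order relation. -/

/-- A colouring `χ` of the rationals by `n` colours is homogeneous if every colour class is
dense. -/
def IsHomogeneousColoring {n : ℕ} (χ : ℚ → Fin n) : Prop :=
  ∀ k : Fin n, Dense (χ ⁻¹' {k})

/-- The smallest class of linear orders that contains `0` and `1` and is closed under order
isomorphisms, binary sums, multiplication by `ω` and by `ω*`, and finitary shuffles.
The product `L · L'` is the ordered sum of copies of `L` indexed by `L'`, that is, `L' × L`
ordered lexicographically; `Ξ(L_0, …, L_{n-1})` is the ordered sum over `q ∈ ℚ` of `L_{χ(q)}`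
for a homogeneous colouring `χ` of `ℚ` by `n` colours. -/
inductive IsFiniteDescription : {α : Type u} → (α → α → Prop) → Prop
  | zero : IsFiniteDescription (emptyRelation : PEmpty.{u + 1} → PEmpty.{u + 1} → Prop)
  | one : IsFiniteDescription (emptyRelation : PUnit.{u + 1} → PUnit.{u + 1} → Prop)
  | add {α β : Type u} {r : α → α → Prop} {s : β → β → Prop} :
      IsFiniteDescription r → IsFiniteDescription s → IsFiniteDescription (Sum.Lex r s)
  | mulOmega {α : Type u} {r : α → α → Prop} :
      IsFiniteDescription r → IsFiniteDescription (Prod.Lex (fun m n : ℕ => m < n) r)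
  | mulOmegaStar {α : Type u} {r : α → α → Prop} :
      IsFiniteDescription r → IsFiniteDescription (Prod.Lex (fun m n : ℕ => n < m) r)
  | shuffle {n : ℕ} {α : Fin n → Type u} {r : ∀ k, α k → α k → Prop} (χ : ℚ → Fin n) :
      IsHomogeneousColoring χ → (∀ k, IsFiniteDescription (r k)) →
      IsFiniteDescription (Sigma.Lex (fun p q : ℚ => p < q) (fun q => r (χ q)))
  | iso {α β : Type u} {r : α → α → Prop} {s : β → β → Prop} :
      r ≃r s → IsFiniteDescription r → IsFiniteDescription s

/-! ## String algebras -/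

/-- The data `(Q, ρ)` of a string algebra `KQ/⟨ρ⟩`, where the quiver `Q` has vertex set `V` and
arrow set `E`. A path `a₁ a₂ … aₙ` of positive length is the list `[a₁, a₂, …, aₙ]` with
`s(aᵢ) = t(aᵢ₊₁)`. -/
structure StringAlgebra (V E : Type u) where
  /-- the source map -/
  s : E → V
  /-- the target map -/
  t : E → V
  /-- the finite set `ρ` of blocking relations -/
  rel : Finset (List E)
  /-- every blocking relation is a path -/
  rel_isPath : ∀ p ∈ rel, p.IsChain (fun a b => s a = t b)
  /-- Admissibility of `⟨ρ⟩`, first half: `⟨ρ⟩` lies in the square of the arrow ideal. -/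
  two_le_length : ∀ p ∈ rel, 2 ≤ p.length
  /-- Admissibility of `⟨ρ⟩`, second half: `⟨ρ⟩` contains a power of the arrow ideal. (A path lies
  in the ideal generated by the set `ρ` of paths iff it has a subpath in `ρ`.) -/
  exists_rel_infix : ∃ N : ℕ, ∀ p : List E, p.IsChain (fun a b => s a = t b) → N ≤ p.length →
    ∃ q ∈ rel, q <:+: p
  /-- at most two arrows have source `v` -/
  encard_source_le : ∀ v : V, {a : E | s a = v}.encard ≤ 2
  /-- at most two arrows have target `v` -/
  encard_target_le : ∀ v : V, {a : E | t a = v}.encard ≤ 2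
  /-- there is at most one arrow `a` such that `ab` is a path that is not in `ρ` -/
  left_unique : ∀ b a a' : E, s a = t b → s a' = t b → [a, b] ∉ rel → [a', b] ∉ rel → a = a'
  /-- there is at most one arrow `c` such that `bc` is a path that is not in `ρ` -/
  right_unique : ∀ b c c' : E, s b = t c → s b = t c' → [b, c] ∉ rel → [b, c'] ∉ rel → c = c'

namespace StringAlgebra

variable {V E : Type u}

/-- The auxiliary maps `σ, τ : Q₁ → {1, -1}`. -/
structure Signs (Λ : StringAlgebra V E) where
  σ : E → ℤˣ
  τ : E → ℤˣ
  source : ∀ a b : E, a ≠ b → Λ.s a = Λ.s b → σ a = -σ b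
  target : ∀ a b : E, a ≠ b → Λ.t a = Λ.t b → τ a = -τ b
  comp : ∀ a b : E, a ≠ b → Λ.s a = Λ.t b → [a, b] ∉ Λ.rel → σ a = -τ b

/-- Syllables: direct ones are the arrows, inverse ones are formal inverses of arrows. -/
inductive Syllable (E : Type u) : Type u
  | direct : E → Syllable E
  | inverse : E → Syllable E

namespace Syllable

/-- The formal inverse of a syllable. -/
def inv : Syllable E → Syllable E
  | direct a => inverse a
  | inverse a => direct a

/-- `0` (that is, `false`) for direct syllables and `1` (that is, `true`) for inverse ones. -/
def sgn : Syllable E → Bool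
  | direct _ => false
  | inverse _ => true

/-- The source of a syllable. -/
def s (Λ : StringAlgebra V E) : Syllable E → V
  | direct a => Λ.s a
  | inverse a => Λ.t a

/-- The target of a syllable. -/
def t (Λ : StringAlgebra V E) : Syllable E → V
  | direct a => Λ.t a
  | inverse a => Λ.s a

/-- The map `σ` on syllables. -/
def σ {Λ : StringAlgebra V E} (ε : Λ.Signs) : Syllable E → ℤˣ
  | direct a => ε.σ a
  | inverse a => ε.τ a

/-- The map `τ` on syllables. -/
def τ {Λ : StringAlgebra V E} (ε : Λ.Signs) : Syllable E → ℤˣ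
  | direct a => ε.τ a
  | inverse a => ε.σ a

end Syllable

/-- `one v i` is the zero-length walk `1_(v,i)`; `word α l` is the non-empty word `α l`
in the syllables. -/
inductive PreWalk (V E : Type u) : Type u
  | one : V → ℤˣ → PreWalk V E
  | word : Syllable E → List (Syllable E) → PreWalk V E

namespace PreWalk

/-- The list of syllables, from left to right. -/
def toList : PreWalk V E → List (Syllable E)
  | one _ _ => []
  | word α l => α :: l

/-- The length of a walk. -/
def length (x : PreWalk V E) : ℕ := x.toList.length

/-- The source: walks are read from right to left. -/
def s (Λ : StringAlgebra V E) : PreWalk V E → V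
  | one v _ => v
  | word α l => ((α :: l).getLast (List.cons_ne_nil α l)).s Λ

/-- The target. -/
def t (Λ : StringAlgebra V E) : PreWalk V E → V
  | one v _ => v
  | word α _ => α.t Λ

/-- The map `σ` on walks. -/
def σ {Λ : StringAlgebra V E} (ε : Λ.Signs) : PreWalk V E → ℤˣ
  | one _ i => -i
  | word α l => ((α :: l).getLast (List.cons_ne_nil α l)).σ ε

/-- The map `τ` on walks. -/
def τ {Λ : StringAlgebra V E} (ε : Λ.Signs) : PreWalk V E → ℤˣ
  | one _ i => i
  | word α _ => α.τ ε

/-- The inverse walk: `1_(v,i)⁻ = 1_(v,-i)` and `(α₁ … αₙ)⁻ = αₙ⁻ … α₁⁻`. -/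
def inv : PreWalk V E → PreWalk V E
  | one v i => one v (-i)
  | word α l =>
      let m := ((α :: l).map Syllable.inv).reverse
      word (m.head (by simp [m])) m.tail

/-- `α₁ … αₙ` is a walk if `s(αᵢ) = t(αᵢ₊₁)` for `0 < i < n`. -/
def IsWalk (Λ : StringAlgebra V E) (x : PreWalk V E) : Prop :=
  x.toList.IsChain (fun α β => α.s Λ = β.t Λ)

/-- A walk is a string if neither a subword of it nor the inverse of a subword lies in `ρ`, and
no syllable is followed by its inverse. -/
structure IsString (Λ : StringAlgebra V E) (x : PreWalk V E) : Prop where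
  isWalk : x.IsWalk Λ
  no_rel : ∀ p ∈ Λ.rel, ¬ p.map Syllable.direct <:+: x.toList
  no_inv_rel : ∀ p ∈ Λ.rel, ¬ (p.map Syllable.inverse).reverse <:+: x.toList
  reduced : x.toList.IsChain (fun α β => α ≠ β.inv)

/-- `IsConcat ε x y z` says that the concatenation `xy` is defined and equal to `z`. For words,
whether `xy` is a walk is part of the predicate `IsString` on `z`. -/
inductive IsConcat {Λ : StringAlgebra V E} (ε : Λ.Signs) :
    PreWalk V E → PreWalk V E → PreWalk V E → Prop
  | one_left (v : V) (i : ℤˣ) (x : PreWalk V E) :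
      x.t Λ = v → x.τ ε = i → IsConcat ε (one v i) x x
  | one_right (v : V) (i : ℤˣ) (x : PreWalk V E) :
      x.s Λ = v → x.σ ε = -i → IsConcat ε x (one v i) x
  | word (α β : Syllable E) (l m : List (Syllable E)) :
      IsConcat ε (word α l) (word β m) (word α (l ++ β :: m))

/-- The sign sequence: `sgn(1_(v,i)) = []` and `sgn(α y) = sgn(y) sgn(α)`. -/
def sgn (x : PreWalk V E) : List Bool :=
  (x.toList.map Syllable.sgn).reverse

/-- `x <_l y`: for the longest `w` with `x = x' w` and `y = y' w`, either `x'` has a direct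
rightmost syllable or `y'` has an inverse rightmost syllable. -/
def LtL (x y : PreWalk V E) : Prop :=
  ∃ w x' y' : List (Syllable E), x.toList = x' ++ w ∧ y.toList = y' ++ w ∧
    (∀ u, u <:+ x.toList → u <:+ y.toList → u.length ≤ w.length) ∧
    ((∃ a, x'.getLast? = some (.direct a)) ∨ (∃ a, y'.getLast? = some (.inverse a)))

/-- `x <_r y` iff `x⁻ <_l y⁻`. -/
def LtR (x y : PreWalk V E) : Prop := x.inv.LtL y.inv

end PreWalk

open PreWalk

variable {Λ : StringAlgebra V E}

/-- The hammock `H(v)` of pairs `(x₁, x₂)` of strings such that `x₁ 1_(v,1)` and `1_(v,1) x₂` are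
defined and `x₁ x₂` is a string. -/
def hammock (ε : Λ.Signs) (v : V) : Set (PreWalk V E × PreWalk V E) :=
  {x | x.1.IsString Λ ∧ x.2.IsString Λ ∧
    IsConcat ε x.1 (one v 1) x.1 ∧ IsConcat ε (one v 1) x.2 x.2 ∧
    ∃ z, IsConcat ε x.1 x.2 z ∧ z.IsString Λ}

/-- `H_l(v)`, the left projection of `H(v)`. -/
def hammockL (ε : Λ.Signs) (v : V) : Set (PreWalk V E) := Prod.fst '' hammock ε v

/-- `H_r(v)`, the right projection of `H(v)`. -/
def hammockR (ε : Λ.Signs) (v : V) : Set (PreWalk V E) := Prod.snd '' hammock ε v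

/-- The relation `<_l` on `H_l(v)`. -/
def hammockL.lt (ε : Λ.Signs) (v : V) (x y : hammockL ε v) : Prop := x.1.LtL y.1

/-- The relation `<_r` on `H_r(v)`. -/
def hammockR.lt (ε : Λ.Signs) (v : V) (x y : hammockR ε v) : Prop := x.1.LtR y.1

end StringAlgebra

/-! ## Automata and linguages -/

/-- A deterministic finite automaton with a partial transition function. -/
structure PartialDFA (A : Type) where
  State : Type u
  finite : Finite State
  start : State
  accept : Set State
  step : State → A → Option State

namespace PartialDFA

/-- The extension of the transition function to words. -/
def run {A : Type} (M : PartialDFA.{u} A) : M.State → List A → Option M.State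
  | q, [] => some q
  | q, a :: x => (M.step q a).bind (fun q' => M.run q' x)

/-- The language of an automaton. -/
def language {A : Type} (M : PartialDFA.{u} A) : Set (List A) :=
  {x | ∃ q ∈ M.accept, M.run M.start x = some q}

end PartialDFA

/-- The inorder on binary words (with `0 = false` and `1 = true`): for the longest word `w` with
`x = w x'` and `y = w y'`, either `x'` begins with `0` or `y'` begins with `1`. -/
def Inorder (x y : List Bool) : Prop :=
  ∃ w x' y' : List Bool, x = w ++ x' ∧ y = w ++ y' ∧
    (∀ u, u <+: x → u <+: y → u.length ≤ w.length) ∧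
    (x'.head? = some false ∨ y'.head? = some true)

/-- The linguage of an automaton over `{0, 1}`: its language, ordered by the inorder. -/
def PartialDFA.linguage (M : PartialDFA.{u} Bool) (x y : M.language) : Prop :=
  Inorder x.1 y.1

/-! ## Word problems and their universal solutions -/

/-- A word problem over the alphabet `Γ` with unknowns `U`: the system `v = W v`, for `v ∈ U`. -/
abbrev WordProblem (Γ : Type) (U : Type u) := U → List (Γ ⊕ U)

/-- An arrangement over `Γ`: a linear order with a colouring function. -/
structure Arrangement (Γ : Type) where
  carrier : Type u
  lt : carrier → carrier → Prop
  isStrictTotalOrder : IsStrictTotalOrder carrier lt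
  color : carrier → Γ

namespace Arrangement

variable {Γ : Type} {U : Type u}

/-- The one-point arrangement of colour `g`. -/
def letter (g : Γ) : Arrangement.{u} Γ where
  carrier := PUnit
  lt := emptyRelation
  isStrictTotalOrder := { trichotomous := by intro a b _ _; rfl }
  color _ := g

/-- The arrangement substituted for a letter or an unknown. -/
def eval (A : U → Arrangement.{u} Γ) : Γ ⊕ U → Arrangement.{u} Γ
  | .inl g => letter g
  | .inr v => A v

/-- The concatenation of the arrangements substituted for the entries of the word `w`. -/
def subst (A : U → Arrangement.{u} Γ) (w : List (Γ ⊕ U)) : Arrangement.{u} Γ where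
  carrier := Σ i : Fin w.length, (eval A (w.get i)).carrier
  lt := Sigma.Lex (fun i j => i < j) (fun i => (eval A (w.get i)).lt)
  isStrictTotalOrder := by
    have := fun i => (eval A (w.get i)).isStrictTotalOrder
    exact { toTrichotomous := inferInstance, toIsStrictOrder := {} }
  color x := (eval A (w.get x.1)).color x.2

/-- An order isomorphism of arrangements that preserves colours. -/
structure Iso (A B : Arrangement.{u} Γ) where
  toRelIso : A.lt ≃r B.lt
  color_eq : ∀ x, B.color (toRelIso x) = A.color x

/-- A morphism of arrangements: an order embedding that preserves colours. -/
structure Hom (A B : Arrangement.{u} Γ) where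
  toRelEmbedding : A.lt ↪r B.lt
  color_eq : ∀ x, B.color (toRelEmbedding x) = A.color x

/-- The action of a family of morphisms on the arrangements substituted for a letter or an
unknown. -/
def evalMap {A B : U → Arrangement.{u} Γ} (f : ∀ v, Hom (A v) (B v)) :
    ∀ c : Γ ⊕ U, (eval A c).carrier → (eval B c).carrier
  | .inl _ => id
  | .inr v => (f v).toRelEmbedding

/-- The action of a family of morphisms on a substituted word. -/
def substMap {A B : U → Arrangement.{u} Γ} (f : ∀ v, Hom (A v) (B v)) (w : List (Γ ⊕ U))
    (x : (subst A w).carrier) : (subst B w).carrier :=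
  ⟨x.1, evalMap f (w.get x.1) x.2⟩

end Arrangement

namespace WordProblem

variable {Γ : Type} {U : Type u}

/-- A solution in arrangements: a family `A` with isomorphisms `A v ≅ (W v)[A]`. -/
structure Solution (W : WordProblem Γ U) where
  arr : U → Arrangement.{u} Γ
  iso : ∀ v, Arrangement.Iso (arr v) (Arrangement.subst arr (W v))

/-- A family of morphisms between the components of two solutions is a morphism of solutions if
it commutes with the isomorphisms that define the solutions. -/
def IsSolutionHom {W : WordProblem Γ U} (S T : Solution W)
    (f : ∀ v, Arrangement.Hom (S.arr v) (T.arr v)) : Prop :=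
  ∀ v x, (T.iso v).toRelIso ((f v).toRelEmbedding x) =
    Arrangement.substMap f (W v) ((S.iso v).toRelIso x)

/-- The universal solution is the initial object of the category of solutions. -/
def Solution.IsUniversal {W : WordProblem Γ U} (S : Solution W) : Prop :=
  ∀ T : Solution W, ∃! f : ∀ v, Arrangement.Hom (S.arr v) (T.arr v), IsSolutionHom S T f

end WordProblem

open Classical in
/-- The word problem of an automaton, with the states as unknowns: `q = δ(q,0) b δ(q,1)`, where
`b` is the letter `⋆` if `q` is accepting and empty otherwise, and `δ(q,d)` is read as the empty
word where it is undefined. -/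
noncomputable def PartialDFA.wordProblem (M : PartialDFA.{u} Bool) :
    WordProblem Unit M.State := fun q =>
  (M.step q false).toList.map Sum.inr ++ (if q ∈ M.accept then [Sum.inl ()] else []) ++
    (M.step q true).toList.map Sum.inr

/-! ## The automaton of a hammock -/

namespace StringAlgebra

open PreWalk

variable {V E : Type u} {Λ : StringAlgebra V E}

/-- The length of the longest relation in `ρ`, and `2` if `ρ` is empty. -/
def maxRelLength (Λ : StringAlgebra V E) : ℕ := max 2 (Λ.rel.sup List.length)

/-- The short strings: those shorter than the longest relation. -/
def Short (Λ : StringAlgebra V E) : Type u :=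
  {x : PreWalk V E // x.IsString Λ ∧ x.length < Λ.maxRelLength}

/-- The longest left factor of `x` of length less than the longest relation. -/
def PreWalk.truncate (Λ : StringAlgebra V E) : PreWalk V E → PreWalk V E
  | one v i => one v i
  | word α l => word α (l.take (Λ.maxRelLength - 2))

theorem PreWalk.truncate_toList_prefix (Λ : StringAlgebra V E) (x : PreWalk V E) :
    (x.truncate Λ).toList <+: x.toList := by
  cases x with
  | one v i => exact List.prefix_rfl
  | word α l => exact List.prefix_cons_inj α |>.2 (List.take_prefix _ _)

theorem PreWalk.truncate_length_lt (Λ : StringAlgebra V E) (x : PreWalk V E) :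
    (x.truncate Λ).length < Λ.maxRelLength := by
  have h : 2 ≤ Λ.maxRelLength := le_max_left _ _
  cases x with
  | one v i => simp only [truncate, length, toList, List.length_nil]; omega
  | word α l =>
    simp only [truncate, length, toList, List.length_cons, List.length_take]; omega

theorem PreWalk.IsString.truncate {x : PreWalk V E} (h : x.IsString Λ) :
    (x.truncate Λ).IsString Λ where
  isWalk := h.isWalk.prefix (truncate_toList_prefix Λ x)
  no_rel p hp hx := h.no_rel p hp (hx.trans (truncate_toList_prefix Λ x).isInfix)
  no_inv_rel p hp hx := h.no_inv_rel p hp (hx.trans (truncate_toList_prefix Λ x).isInfix)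
  reduced := h.reduced.prefix (truncate_toList_prefix Λ x)

/-- The map `x ↦ [x]` from strings to short strings. -/
def toShort (x : PreWalk V E) (h : x.IsString Λ) : Λ.Short :=
  ⟨x.truncate Λ, h.truncate, x.truncate_length_lt Λ⟩

theorem finite_short [Finite V] [Finite E] (Λ : StringAlgebra V E) : Finite Λ.Short := by
  have e : Finite (Syllable E) := by
    refine Finite.of_injective
      (fun α : Syllable E => match α with | .direct a => (Sum.inl a : E ⊕ E) | .inverse a => .inr a)
      ?_
    rintro (a | a) (b | b) h <;> simp_all
  have hl := (List.finite_length_lt (Syllable E) Λ.maxRelLength).to_subtype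
  let f : Λ.Short → (Option (V × ℤˣ)) × {l : List (Syllable E) // l.length < Λ.maxRelLength} :=
    fun x => (match x.1 with | .one v i => some (v, i) | .word _ _ => none,
      ⟨x.1.toList, x.2.2⟩)
  have : Finite {l : List (Syllable E) // l.length < Λ.maxRelLength} := hl
  refine Finite.of_injective f ?_
  rintro ⟨x, hx⟩ ⟨y, hy⟩ h
  apply Subtype.ext
  cases x <;> cases y <;> simp_all [f, toList]

/-- `z = β x` is a string for some syllable `β` of sign `c`. -/
def IsExtension (ε : Λ.Signs) (x : PreWalk V E) (c : Bool) (z : PreWalk V E) : Prop :=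
  z.IsString Λ ∧ ∃ β : Syllable E, β.sgn = c ∧ IsConcat ε (word β []) x z

open Classical in
/-- The automaton `M'_Λ(v)`: its states are the short strings, all accepting, the start state is
`1_(v,1)`, and `δ(x, c) = [β x]` if there is a (then unique) syllable `β` of sign `c` such that
`β x` is a string. -/
noncomputable def automaton [Finite V] [Finite E] (ε : Λ.Signs) (v : V) :
    PartialDFA.{u} Bool where
  State := Λ.Short
  finite := Λ.finite_short
  start := ⟨one v 1,
    { isWalk := List.isChain_nil
      no_rel := fun p hp h => by
        have h2 := Λ.two_le_length p hp
        have := h.length_le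
        simp only [toList, List.length_map, List.length_nil] at this
        omega
      no_inv_rel := fun p hp h => by
        have h2 := Λ.two_le_length p hp
        have := h.length_le
        simp only [toList, List.length_map, List.length_reverse, List.length_nil] at this
        omega
      reduced := List.isChain_nil },
    lt_of_lt_of_le (by simp [length, toList]) (le_max_left 2 _)⟩
  accept := Set.univ
  step x c :=
    if h : ∃ z, IsExtension ε x.1 c z then some (toShort h.choose h.choose_spec.1) else none

end StringAlgebra

/-! ## The inorder on binary words -/

/-! The map `inorderVal` embeds the inorder into the rationals, so every set of binary words is
linearly ordered, and countably many words suffice to realise shuffles.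

The core is `finiteDescriptionOn_languageFrom`: the words accepted from any state of a finite
automaton form a finite description order. The proof is by induction on the number of reachable
states. If the state lies on no cycle, its language is the sum of the language of the 0-successor,
at most one point, and the language of the 1-successor. Otherwise let `C` be its strongly connected
component; languages of states reached by leaving `C` are known by induction. In the tree of paths
inside `C` there is a leftmost and a rightmost infinite path. Both are eventually periodic, because
there are finitely many states, so the words leaving such a path on its outer side form a finite sum
followed or preceded by an ω-fold or ω*-fold repetition (`finiteDescriptionOn_exit`). Every other
word is attached to a branching node, where both directions stay in `C`. The words attached to one
node form a block, whose order type depends only on the state at the node: the words leaving the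
rightmost path of its left subtree on the right, the node itself, and the words leaving the leftmost
path of its right subtree on the left. By strong connectedness, nodes of every branching state occur
between any two nodes, so the blocks form a shuffle (`iUnion_dense`).

For hammocks, the sign of a syllable determines it once the string to its right is known
(`syllable_unique`), so a string is coded by its sign word and the hammock order becomes the inorder
(`ltL_iff`). Whether a syllable extends a string depends only on the longest short left factor
(`isString_word_cons_iff`), so the automaton accepts exactly the sign words of strings
(`automaton_run_eq_some`). Right hammocks are left ones after inversion.

For universal solutions, the languages of the states solve the word problem by stripping the first
letter. Stripping shortens words, so a morphism to any other solution exists and is unique by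
recursion on length (`isUniversal_of_rank`). Initial objects are isomorphic, which transfers the
result to every universal solution. -/

/-- The position of a binary word in the inorder, as a rational number in `(-1, 1)`. -/
def inorderVal : List Bool → ℚ
  | [] => 0
  | false :: x => (inorderVal x - 1) / 2
  | true :: x => (inorderVal x + 1) / 2

theorem inorderVal_mem (x : List Bool) : -1 < inorderVal x ∧ inorderVal x < 1 := by
  induction x with
  | nil => simp [inorderVal]
  | cons c x ih => cases c <;> simp only [inorderVal] <;> constructor <;> linarith [ih.1, ih.2]

theorem inorderVal_false_neg (x : List Bool) : inorderVal (false :: x) < 0 := by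
  have := inorderVal_mem x
  simp only [inorderVal]; linarith

theorem inorderVal_true_pos (x : List Bool) : 0 < inorderVal (true :: x) := by
  have := inorderVal_mem x
  simp only [inorderVal]; linarith

theorem inorderVal_false_lt_true (x y : List Bool) :
    inorderVal (false :: x) < inorderVal (true :: y) :=
  (inorderVal_false_neg x).trans (inorderVal_true_pos y)

theorem inorderVal_cons_lt_cons {c : Bool} {x y : List Bool} :
    inorderVal (c :: x) < inorderVal (c :: y) ↔ inorderVal x < inorderVal y := by
  cases c <;> simp only [inorderVal] <;> constructor <;> intro h <;> linarith

theorem inorderVal_append_lt_append {u x y : List Bool} :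
    inorderVal (u ++ x) < inorderVal (u ++ y) ↔ inorderVal x < inorderVal y := by
  induction u with
  | nil => rfl
  | cons c u ih => simpa only [List.cons_append, inorderVal_cons_lt_cons] using ih

theorem inorderVal_injective : Function.Injective inorderVal := by
  intro x
  induction x with
  | nil =>
    rintro (_ | ⟨_ | _, y⟩) h
    · rfl
    · exact absurd h (inorderVal_false_neg y).ne'
    · exact absurd h (inorderVal_true_pos y).ne
  | cons c x ih =>
    rintro (_ | ⟨d, y⟩) h
    · cases c
      · exact absurd h (inorderVal_false_neg x).ne
      · exact absurd h (inorderVal_true_pos x).ne'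
    · cases c <;> cases d
      · exact congrArg _ (ih (by simp only [inorderVal] at h; linarith))
      · exact absurd h (inorderVal_false_lt_true x y).ne
      · exact absurd h (inorderVal_false_lt_true y x).ne'
      · exact congrArg _ (ih (by simp only [inorderVal] at h; linarith))

theorem head_of_inorderVal_lt {x y : List Bool} (h : inorderVal x < inorderVal y) :
    x.head? = some false ∨ y.head? = some true := by
  rcases x with _ | ⟨_ | _, x⟩ <;> rcases y with _ | ⟨_ | _, y⟩
  · exact absurd h (lt_irrefl _)
  · exact absurd h (inorderVal_false_neg y).not_gt
  · simp
  · simp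
  · simp
  · simp
  · exact absurd h (inorderVal_true_pos x).not_gt
  · exact absurd h (inorderVal_false_lt_true y x).not_gt
  · simp

theorem inorderVal_lt_of_head {x y : List Bool} (hne : x.head? = y.head? → x.head? = none)
    (h : x.head? = some false ∨ y.head? = some true) : inorderVal x < inorderVal y := by
  rcases x with _ | ⟨_ | _, x⟩ <;> rcases y with _ | ⟨_ | _, y⟩ <;> simp_all
  · exact inorderVal_true_pos y
  · exact inorderVal_false_neg x
  · exact inorderVal_false_lt_true x y

theorem exists_longest_common_prefix {α : Type*} (x y : List α) :
    ∃ w x' y', x = w ++ x' ∧ y = w ++ y' ∧ (x'.head? = y'.head? → x'.head? = none) ∧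
      ∀ u, u <+: x → u <+: y → u.length ≤ w.length := by
  induction x generalizing y with
  | nil => exact ⟨[], [], y, by simp⟩
  | cons c x ih =>
    rcases y with _ | ⟨d, y⟩
    · exact ⟨[], c :: x, [], by simp⟩
    · by_cases hcd : c = d
      · subst hcd
        obtain ⟨w, x', y', rfl, rfl, h, hw⟩ := ih y
        refine ⟨c :: w, x', y', rfl, rfl, h, ?_⟩
        rintro (_ | ⟨e, u⟩) hx hy
        · simp
        · simp only [List.cons_prefix_cons] at hx hy
          simpa using hw u hx.2 hy.2
      · refine ⟨[], c :: x, d :: y, rfl, rfl, by simp [hcd], ?_⟩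
        rintro (_ | ⟨e, u⟩) hx hy
        · simp
        · simp only [List.cons_prefix_cons] at hx hy
          exact absurd (hx.1.symm.trans hy.1) hcd

/-- The maximality condition in `Inorder` forces the two remainders to differ in their first letter,
and that letter alone decides the comparison of values. -/
theorem inorder_iff {x y : List Bool} : Inorder x y ↔ inorderVal x < inorderVal y := by
  constructor
  · rintro ⟨w, x', y', rfl, rfl, hw, h⟩
    refine inorderVal_append_lt_append.2 (inorderVal_lt_of_head (fun he => ?_) h)
    rcases x' with _ | ⟨c, x'⟩
    · rfl
    · rcases y' with _ | ⟨d, y'⟩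
      · simp at he
      · simp only [List.head?_cons, Option.some.injEq] at he
        subst he
        have := hw (w ++ [c]) (by simp) (by simp)
        simp at this
  · intro h
    obtain ⟨w, x', y', rfl, rfl, _, hw⟩ := exists_longest_common_prefix x y
    exact ⟨w, x', y', rfl, rfl, hw, head_of_inorderVal_lt (inorderVal_append_lt_append.1 h)⟩

/-- When `y` is not a prefix of `x`, the comparison is decided by a letter of `y`, so what follows
`y` is irrelevant. This lemma and the next allow one end of an interval to be extended without
leaving the interval. -/
theorem inorderVal_lt_append {x y : List Bool} (z : List Bool) (h : inorderVal x < inorderVal y)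
    (hy : ¬ y <+: x) : inorderVal x < inorderVal (y ++ z) := by
  induction y generalizing x with
  | nil => simp at hy
  | cons d y ih =>
    rcases x with _ | ⟨c, x⟩
    · cases d
      · exact absurd h (inorderVal_false_neg y).not_gt
      · exact inorderVal_true_pos _
    · by_cases hcd : c = d
      · subst hcd
        rw [List.cons_append, inorderVal_cons_lt_cons]
        exact ih (inorderVal_cons_lt_cons.1 h) (by simpa using hy)
      · cases c <;> cases d <;> simp at hcd
        · exact inorderVal_false_lt_true _ _
        · exact absurd h (inorderVal_false_lt_true y x).not_gt

theorem inorderVal_append_lt {x y : List Bool} (z : List Bool) (h : inorderVal x < inorderVal y)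
    (hy : ¬ x <+: y) : inorderVal (x ++ z) < inorderVal y := by
  induction x generalizing y with
  | nil => simp at hy
  | cons d x ih =>
    rcases y with _ | ⟨c, y⟩
    · cases d
      · exact inorderVal_false_neg _
      · exact absurd h (inorderVal_true_pos x).not_gt
    · by_cases hcd : c = d
      · subst hcd
        rw [List.cons_append, inorderVal_cons_lt_cons]
        exact ih (inorderVal_cons_lt_cons.1 h) (by simpa using hy)
      · cases c <;> cases d <;> simp at hcd
        · exact absurd h (inorderVal_false_lt_true y x).not_gt
        · exact inorderVal_false_lt_true _ _

/-- The inorder, restricted to a set of words. -/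
def InorderOn (s : Set (List Bool)) (x y : s) : Prop := inorderVal x.1 < inorderVal y.1

instance (s : Set (List Bool)) : IsStrictTotalOrder s (InorderOn s) where
  trichotomous _ _ h h' :=
    Subtype.ext (inorderVal_injective (le_antisymm (not_lt.1 h') (not_lt.1 h)))
  irrefl x := lt_irrefl (inorderVal x.1)
  trans _ _ _ := lt_trans

/-! ## Sets of words of finite description -/

/-- A set of words, ordered by the inorder, is a finite description linear order. -/
def FiniteDescriptionOn (s : Set (List Bool)) : Prop := IsFiniteDescription (InorderOn s)

namespace FiniteDescriptionOn

/-- A strictly increasing map out of a trichotomous relation is an embedding, so only the forward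
implication has to be checked. -/
theorem of_map {β : Type} {r : β → β → Prop} [Std.Trichotomous r] (hr : IsFiniteDescription r)
    {s : Set (List Bool)} (f : β → List Bool)
    (hf : ∀ a b, r a b → inorderVal (f a) < inorderVal (f b)) (hs : ∀ x, x ∈ s ↔ ∃ b, f b = x) :
    FiniteDescriptionOn s := by
  let g : r ↪r InorderOn s :=
    RelEmbedding.ofMonotone (fun b => ⟨f b, (hs _).2 ⟨b, rfl⟩⟩) fun a b h => hf a b h
  refine hr.iso (RelIso.ofSurjective g ?_)
  rintro ⟨x, hx⟩
  obtain ⟨b, rfl⟩ := (hs x).1 hx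
  exact ⟨b, rfl⟩

theorem empty : FiniteDescriptionOn ∅ :=
  have : Std.Trichotomous (emptyRelation : PEmpty.{1} → PEmpty.{1} → Prop) := ⟨fun a => a.elim⟩
  of_map .zero PEmpty.elim (fun a => a.elim) (by simp)

theorem singleton (x : List Bool) : FiniteDescriptionOn {x} :=
  have : Std.Trichotomous (emptyRelation : PUnit.{1} → PUnit.{1} → Prop) := ⟨fun _ _ _ _ => rfl⟩
  of_map .one (fun _ => x) (fun _ _ h => h.elim) (by simp [eq_comm])

theorem sep_singleton (x : List Bool) (p : Prop) : FiniteDescriptionOn {w | w = x ∧ p} := by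
  by_cases hp : p
  · simpa [hp] using singleton x
  · simpa [hp] using empty

theorem union {s t : Set (List Bool)} (hs : FiniteDescriptionOn s) (ht : FiniteDescriptionOn t)
    (h : ∀ x ∈ s, ∀ y ∈ t, inorderVal x < inorderVal y) : FiniteDescriptionOn (s ∪ t) := by
  refine of_map (hs.add ht) (Sum.elim (fun x => x.1) (fun x => x.1)) ?_ (by simp)
  rintro _ _ (h' | h' | _)
  · exact h'
  · exact h'
  · exact h _ (Subtype.mem _) _ (Subtype.mem _)

theorem image_append {s : Set (List Bool)} (hs : FiniteDescriptionOn s) (u : List Bool) :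
    FiniteDescriptionOn ((u ++ ·) '' s) :=
  of_map hs (fun x => u ++ x.1) (fun _ _ h => inorderVal_append_lt_append.2 h) (by simp)

theorem image_cons {s : Set (List Bool)} (hs : FiniteDescriptionOn s) (c : Bool) :
    FiniteDescriptionOn ((c :: ·) '' s) := hs.image_append [c]

end FiniteDescriptionOn

/-! ### Comparison relative to a side, and ω-fold repetition -/

/-- The inorder if `e = true` and its reverse if `e = false`. -/
def SideLT (e : Bool) (x y : List Bool) : Prop :=
  if e then inorderVal x < inorderVal y else inorderVal y < inorderVal x

theorem sideLT_not_cons_nil (e : Bool) (x : List Bool) : SideLT e ((!e) :: x) [] := by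
  cases e
  · exact inorderVal_true_pos x
  · exact inorderVal_false_neg x

theorem sideLT_nil_cons (e : Bool) (x : List Bool) : SideLT e [] (e :: x) := by
  cases e
  · exact inorderVal_false_neg x
  · exact inorderVal_true_pos x

theorem sideLT_not_cons_cons (e : Bool) (x y : List Bool) : SideLT e ((!e) :: x) (e :: y) := by
  cases e
  · exact inorderVal_false_lt_true y x
  · exact inorderVal_false_lt_true x y

theorem sideLT_append {e : Bool} {u x y : List Bool} :
    SideLT e (u ++ x) (u ++ y) ↔ SideLT e x y := by
  cases e <;> exact inorderVal_append_lt_append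

theorem sideLT_cons {e c : Bool} {x y : List Bool} :
    SideLT e (c :: x) (c :: y) ↔ SideLT e x y := sideLT_append (u := [c])

namespace FiniteDescriptionOn

theorem union_side (e : Bool) {s t : Set (List Bool)} (hs : FiniteDescriptionOn s)
    (ht : FiniteDescriptionOn t) (h : ∀ x ∈ s, ∀ y ∈ t, SideLT e x y) :
    FiniteDescriptionOn (s ∪ t) := by
  cases e
  · rw [Set.union_comm]
    exact ht.union hs fun x hx y hy => h y hy x hx
  · exact hs.union ht h

theorem iterate_append_lt {e : Bool} {u : List Bool} {x y : List Bool} {m n : ℕ} (hmn : m < n)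
    (hx : ∀ z, SideLT e (u ++ z) x) : SideLT e ((u ++ ·)^[n] y) ((u ++ ·)^[m] x) := by
  induction m generalizing n with
  | zero =>
    obtain ⟨n, rfl⟩ := Nat.exists_eq_succ_of_ne_zero hmn.ne'
    rw [Function.iterate_succ_apply']
    exact hx _
  | succ m ih =>
    obtain ⟨n, rfl⟩ := Nat.exists_eq_succ_of_ne_zero (Nat.zero_lt_of_lt hmn).ne'
    rw [Function.iterate_succ_apply', Function.iterate_succ_apply']
    exact sideLT_append.2 (ih (by omega))

theorem inorderVal_iterate_append {u x y : List Bool} (n : ℕ) (h : inorderVal x < inorderVal y) :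
    inorderVal ((u ++ ·)^[n] x) < inorderVal ((u ++ ·)^[n] y) := by
  induction n with
  | zero => exact h
  | succ n ih =>
    rw [Function.iterate_succ_apply', Function.iterate_succ_apply']
    exact inorderVal_append_lt_append.2 ih

/-- Unfolding the equation for `t` gives the disjoint layers `s`, `u s`, `u u s`, and so on, each
isomorphic to `s`, and each lying on the `!e` side of the previous one. -/
theorem of_eq_union_append (e : Bool) {s t : Set (List Bool)} {u : List Bool} (hu : u ≠ [])
    (hs : FiniteDescriptionOn s) (ht : t = s ∪ (u ++ ·) '' t)
    (h : ∀ x ∈ s, ∀ z, SideLT e (u ++ z) x) : FiniteDescriptionOn t := by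
  -- Since `u` is non-empty, each unfolding shortens the word, so every word of `t` lies in some
  -- layer.
  have key : ∀ x, x ∈ t ↔ ∃ b : ℕ × s, (u ++ ·)^[b.1] b.2.1 = x := by
    intro x
    constructor
    · intro hx
      induction hn : x.length using Nat.strong_induction_on generalizing x with
      | _ n ih =>
        rw [ht] at hx
        rcases hx with hx | ⟨y, hy, rfl⟩
        · exact ⟨⟨0, x, hx⟩, rfl⟩
        · have : 0 < u.length := List.length_pos_iff.2 hu
          obtain ⟨⟨k, b⟩, rfl⟩ := ih y.length (by simp at hn; omega) y hy rfl
          exact ⟨⟨k + 1, b⟩, Function.iterate_succ_apply' _ _ _⟩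
    · rintro ⟨⟨k, b⟩, rfl⟩
      induction k with
      | zero => rw [ht]; exact Or.inl b.2
      | succ k ih => rw [ht]; exact Or.inr ⟨_, ih, (Function.iterate_succ_apply' _ _ _).symm⟩
  -- For `e = false` the layers ascend and give multiplication by ω; for `e = true` they descend and
  -- give ω*.
  cases e
  · refine of_map hs.mulOmega _ ?_ key
    rintro _ _ (⟨_, _, h'⟩ | ⟨_, h'⟩)
    · exact iterate_append_lt (e := false) h' (h _ (Subtype.mem _))
    · exact inorderVal_iterate_append _ h'
  · have : Std.Trichotomous (fun m n : ℕ => n < m) := ⟨fun a b h h' => by omega⟩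
    refine of_map hs.mulOmegaStar _ ?_ key
    rintro _ _ (⟨_, _, h'⟩ | ⟨_, h'⟩)
    · exact iterate_append_lt (e := true) h' (h _ (Subtype.mem _))
    · exact inorderVal_iterate_append _ h'

/-- A family of finitely many finite description orders, spread along a countable dense set of
words in such a way that each member occurs between any two words. -/
theorem iUnion_dense {B : Type*} [Finite B] {b : B → Set (List Bool)}
    (hb : ∀ k, FiniteDescriptionOn (b k)) {N : Set (List Bool)} (c : N → B) (hN : N.Nonempty)
    (hlt : ∀ x : N, ∀ k, ∃ y : N, c y = k ∧ inorderVal y < inorderVal x)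
    (hgt : ∀ x : N, ∀ k, ∃ y : N, c y = k ∧ inorderVal x < inorderVal y)
    (hbtw : ∀ x y : N, inorderVal x < inorderVal y → ∀ k, ∃ z : N, c z = k ∧
      inorderVal x < inorderVal z ∧ inorderVal z < inorderVal y)
    (hmono : ∀ x y : N, inorderVal x < inorderVal y → ∀ v ∈ b (c x), ∀ w ∈ b (c y),
      inorderVal (x ++ v) < inorderVal (y ++ w)) :
    FiniteDescriptionOn {w | ∃ x : N, ∃ v ∈ b (c x), w = x ++ v} := by
  obtain ⟨n, ⟨e⟩⟩ := Finite.exists_equiv_fin B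
  obtain ⟨x₀, hx₀⟩ := hN
  let R : Set ℚ := inorderVal '' N
  let k₀ := c ⟨x₀, hx₀⟩
  have : Nonempty R := ⟨⟨_, x₀, hx₀, rfl⟩⟩
  have : NoMinOrder R := ⟨by
    rintro ⟨_, x, hx, rfl⟩
    obtain ⟨y, -, h⟩ := hlt ⟨x, hx⟩ k₀
    exact ⟨⟨_, y, y.2, rfl⟩, h⟩⟩
  have : NoMaxOrder R := ⟨by
    rintro ⟨_, x, hx, rfl⟩
    obtain ⟨y, -, h⟩ := hgt ⟨x, hx⟩ k₀
    exact ⟨⟨_, y, y.2, rfl⟩, h⟩⟩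
  have : DenselyOrdered R := ⟨by
    rintro ⟨_, x, hx, rfl⟩ ⟨_, y, hy, rfl⟩ h
    obtain ⟨z, -, h⟩ := hbtw ⟨x, hx⟩ ⟨y, hy⟩ h k₀
    exact ⟨⟨_, z, z.2, rfl⟩, h⟩⟩
  -- Cantor's theorem: the values of the words in `N` form a countable dense order without
  -- endpoints.
  obtain ⟨ψ⟩ := Order.iso_of_countable_dense ℚ R
  have hψ : ∀ q, ∃ x : N, inorderVal x = ψ q := fun q => by
    obtain ⟨x, hx, h⟩ := (ψ q).2
    exact ⟨⟨x, hx⟩, h⟩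
  choose φ hφ using hψ
  have hφlt : ∀ {p q}, p < q → inorderVal (φ p) < inorderVal (φ q) := fun h => by
    rw [hφ, hφ]; exact ψ.strictMono h
  have hφsurj : ∀ x : N, ∃ q, φ q = x := fun x => by
    obtain ⟨q, hq⟩ := ψ.surjective ⟨_, x, x.2, rfl⟩
    refine ⟨q, Subtype.ext (inorderVal_injective ?_)⟩
    rw [hφ, hq]
  have hχ : IsHomogeneousColoring (fun q => e (c (φ q))) := by
    intro k
    refine dense_of_exists_between fun p q hpq => ?_
    obtain ⟨z, hz, h1, h2⟩ := hbtw _ _ (hφlt hpq) (e.symm k)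
    obtain ⟨r, rfl⟩ := hφsurj z
    refine ⟨r, by simp [hz], ?_, ?_⟩
    · by_contra hr
      rcases (not_lt.1 hr).lt_or_eq with h | h
      · exact (hφlt h).not_gt h1
      · exact lt_irrefl _ (h ▸ h1)
    · by_contra hr
      rcases (not_lt.1 hr).lt_or_eq with h | h
      · exact (hφlt h).not_gt h2
      · exact lt_irrefl _ (h ▸ h2)
  refine of_map (IsFiniteDescription.shuffle _ hχ fun k => hb (e.symm k))
    (fun x => (φ x.1).1 ++ x.2.1) ?_ ?_
  · rintro _ _ (⟨v, w, h⟩ | ⟨v, w, h⟩)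
    · exact hmono _ _ (hφlt h) _ (by simpa using v.2) _ (by simpa using w.2)
    · exact inorderVal_append_lt_append.2 h
  · intro w
    constructor
    · rintro ⟨x, v, hv, rfl⟩
      obtain ⟨q, rfl⟩ := hφsurj x
      exact ⟨⟨q, v, by simpa using hv⟩, rfl⟩
    · rintro ⟨⟨q, v⟩, rfl⟩
      exact ⟨φ q, v, by simpa using v.2, rfl⟩

end FiniteDescriptionOn

/-! ## Linguages are finite description linear orders -/

namespace PartialDFA

theorem run_append {A : Type} (M : PartialDFA.{u} A) (q : M.State) (x y : List A) :
    M.run q (x ++ y) = (M.run q x).bind fun p => M.run p y := by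
  induction x generalizing q with
  | nil => rfl
  | cons a x ih =>
    simp only [List.cons_append, run]
    cases M.step q a with
    | none => rfl
    | some p => exact ih p

theorem run_cons {A : Type} (M : PartialDFA.{u} A) {p p' : M.State} {a : A}
    (h : M.step p a = some p') (x : List A) : M.run p (a :: x) = M.run p' x := by
  simp [run, h]

variable (M : PartialDFA.{u} Bool)

/-- The words accepted from the state `q`. -/
def languageFrom (q : M.State) : Set (List Bool) := {x | ∃ p ∈ M.accept, M.run q x = some p}

theorem nil_mem_languageFrom {q : M.State} : [] ∈ M.languageFrom q ↔ q ∈ M.accept := by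
  simp [languageFrom, run]

theorem cons_mem_languageFrom {q : M.State} {c : Bool} {x : List Bool} :
    c :: x ∈ M.languageFrom q ↔ ∃ p, M.step q c = some p ∧ x ∈ M.languageFrom p := by
  simp only [languageFrom, run, Set.mem_ofPred_eq, Option.bind_eq_some_iff]
  tauto

theorem append_mem_languageFrom {q p : M.State} {x y : List Bool} (h : M.run q x = some p) :
    x ++ y ∈ M.languageFrom q ↔ y ∈ M.languageFrom p := by
  simp [languageFrom, run_append, h]

/-- The words of length at least one that are accepted from `q` and begin with `c`. -/
theorem finiteDescriptionOn_cons {q : M.State} {c : Bool}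
    (h : ∀ p, M.step q c = some p → FiniteDescriptionOn (M.languageFrom p)) :
    FiniteDescriptionOn {w | ∃ p, M.step q c = some p ∧ ∃ x ∈ M.languageFrom p, w = c :: x} := by
  cases hq : M.step q c with
  | none => simpa using FiniteDescriptionOn.empty
  | some p =>
    convert (h p hq).image_cons c using 1
    ext w
    simp [eq_comm]

/-! ### Decomposition of the language along one strongly connected component -/

section Component

variable (C : Set M.State)

/-- The `c`-successor of `p` exists and lies in `C`. -/
def Stays (c : Bool) (p : M.State) : Prop := ∃ p' ∈ C, M.step p c = some p'

open Classical in
/-- The direction in which one can stay in `C`, with a preference for `e`. -/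
noncomputable def direction (e : Bool) (p : M.State) : Bool := if M.Stays C e p then e else !e

/-- The words accepted from a state that leave, on the side `e`, the path in `C` which proceeds
in the direction `e` whenever possible. -/
inductive Exit (e : Bool) : M.State → List Bool → Prop
  | here {p : M.State} : ¬ M.Stays C e p → p ∈ M.accept → Exit e p []
  | leave {p p' : M.State} {x : List Bool} : ¬ M.Stays C e p → M.step p e = some p' →
      x ∈ M.languageFrom p' → Exit e p (e :: x)
  | stay {p p' : M.State} {x : List Bool} : M.step p (M.direction C e p) = some p' →
      Exit e p' x → Exit e p (M.direction C e p :: x)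

/-- The words, accepted from a branching state, that are not separated from the empty word by a
branching node. -/
def block (p : M.State) : Set (List Bool) :=
  {w | (∃ p', M.step p false = some p' ∧ ∃ x, M.Exit C true p' x ∧ w = false :: x) ∨
    (w = [] ∧ p ∈ M.accept) ∨
    ∃ p', M.step p true = some p' ∧ ∃ x, M.Exit C false p' x ∧ w = true :: x}

/-- The states from which one can stay in `C` in both directions. -/
def branching : Set M.State := {p | p ∈ C ∧ ∀ c, M.Stays C c p}

variable {M C}

theorem direction_of_stays {e : Bool} {p : M.State} (h : M.Stays C e p) :
    M.direction C e p = e := if_pos h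

theorem direction_of_not_stays {e : Bool} {p : M.State} (h : ¬ M.Stays C e p) :
    M.direction C e p = !e := if_neg h

theorem exit_iff {e : Bool} {p : M.State} {w : List Bool} :
    M.Exit C e p w ↔ (¬ M.Stays C e p ∧ ((w = [] ∧ p ∈ M.accept) ∨
      ∃ p', M.step p e = some p' ∧ ∃ x ∈ M.languageFrom p', w = e :: x)) ∨
      ∃ p', M.step p (M.direction C e p) = some p' ∧ ∃ x, M.Exit C e p' x ∧
        w = M.direction C e p :: x := by
  constructor
  · rintro (⟨h1, h2⟩ | ⟨h1, h2, h3⟩ | ⟨h1, h2⟩)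
    · exact Or.inl ⟨h1, Or.inl ⟨rfl, h2⟩⟩
    · exact Or.inl ⟨h1, Or.inr ⟨_, h2, _, h3, rfl⟩⟩
    · exact Or.inr ⟨_, h1, _, h2, rfl⟩
  · rintro (⟨h1, ⟨rfl, h2⟩ | ⟨p', h2, x, h3, rfl⟩⟩ | ⟨p', h1, x, h2, rfl⟩)
    · exact .here h1 h2
    · exact .leave h1 h2 h3
    · exact .stay h1 h2

theorem Exit.mem_languageFrom {e : Bool} {p : M.State} {w : List Bool} (h : M.Exit C e p w) :
    w ∈ M.languageFrom p := by
  induction h with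
  | here _ h => exact (M.nil_mem_languageFrom).2 h
  | leave _ h1 h2 => exact (M.cons_mem_languageFrom).2 ⟨_, h1, h2⟩
  | stay h1 _ ih => exact (M.cons_mem_languageFrom).2 ⟨_, h1, ih⟩

theorem mem_languageFrom_of_mem_block {p : M.State} {w : List Bool} (h : w ∈ M.block C p) :
    w ∈ M.languageFrom p := by
  rcases h with ⟨p', h1, x, h2, rfl⟩ | ⟨rfl, h⟩ | ⟨p', h1, x, h2, rfl⟩
  · exact (M.cons_mem_languageFrom).2 ⟨_, h1, h2.mem_languageFrom⟩
  · exact (M.nil_mem_languageFrom).2 h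
  · exact (M.cons_mem_languageFrom).2 ⟨_, h1, h2.mem_languageFrom⟩

theorem stays_direction (hC : ∀ p ∈ C, ∃ c, M.Stays C c p) {e : Bool} {p : M.State}
    (hp : p ∈ C) : M.Stays C (M.direction C e p) p := by
  by_cases h : M.Stays C e p
  · rwa [direction_of_stays h]
  · rw [direction_of_not_stays h]
    obtain ⟨c, hc⟩ := hC p hp
    rcases Bool.eq_or_eq_not c e with rfl | rfl
    · exact absurd hc h
    · exact hc

/-- The exits from the first `n` steps of a path in `C`. -/
theorem exit_eq_union
    (hfd : ∀ p ∈ C, ∀ c p', M.step p c = some p' → p' ∉ C →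
      FiniteDescriptionOn (M.languageFrom p')) (e : Bool) {F : M.State → M.State}
    (hF : ∀ p ∈ C, F p ∈ C ∧ M.step p (M.direction C e p) = some (F p)) (n : ℕ) :
    ∀ p ∈ C, ∃ u : List Bool, u.length = n ∧ ∃ s, FiniteDescriptionOn s ∧
      {w | M.Exit C e p w} = s ∪ (u ++ ·) '' {w | M.Exit C e (F^[n] p) w} ∧
      ∀ x ∈ s, ∀ z, SideLT e (u ++ z) x := by
  induction n with
  | zero => exact fun p _ => ⟨[], rfl, ∅, .empty, by simp, by simp⟩
  | succ n ih =>
    intro p hp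
    obtain ⟨u, rfl, s, hs, hst, h⟩ := ih (F p) (hF p hp).1
    set d := M.direction C e p with hd
    have hsplit : {w | M.Exit C e p w} = {w | ¬ M.Stays C e p ∧ ((w = [] ∧ p ∈ M.accept) ∨
        ∃ p', M.step p e = some p' ∧ ∃ x ∈ M.languageFrom p', w = e :: x)} ∪
        (d :: ·) '' {w | M.Exit C e (F p) w} := by
      ext w
      simp only [Set.mem_ofPred_eq, Set.mem_union, Set.mem_image]
      rw [exit_iff, ← hd, (hF p hp).2]
      simp [eq_comm]
    set t := {w | ¬ M.Stays C e p ∧ ((w = [] ∧ p ∈ M.accept) ∨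
        ∃ p', M.step p e = some p' ∧ ∃ x ∈ M.languageFrom p', w = e :: x)} with htdef
    have ht : FiniteDescriptionOn t ∧ ∀ x ∈ t, ∀ z, SideLT e (d :: z) x := by
      -- If the path turns to `e` at `p`, nothing leaves it there on that side. Otherwise it turns
      -- to `!e`, and both the node and everything behind its `e`-edge lie on the side `e` of all
      -- later words of the path.
      by_cases hst : M.Stays C e p
      · have : t = ∅ := by ext w; simp [htdef, hst]
        rw [this]
        exact ⟨.empty, by simp⟩
      · have hde : d = !e := direction_of_not_stays hst
        rw [hde]
        constructor
        · have : t = {w | w = [] ∧ p ∈ M.accept} ∪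
            {w | ∃ p', M.step p e = some p' ∧ ∃ x ∈ M.languageFrom p', w = e :: x} := by
            ext w; simp [htdef, hst]
          rw [this]
          refine (FiniteDescriptionOn.sep_singleton _ _).union_side e
            (M.finiteDescriptionOn_cons fun p' h' => hfd p hp e p' h' fun hp' => hst ⟨p', hp', h'⟩)
            ?_
          rintro _ ⟨rfl, -⟩ _ ⟨_, _, x, _, rfl⟩
          exact sideLT_nil_cons _ _
        · rintro _ ⟨-, ⟨rfl, -⟩ | ⟨p', _, x, _, rfl⟩⟩ z
          · exact sideLT_not_cons_nil _ _
          · exact sideLT_not_cons_cons _ _ _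
    refine ⟨d :: u, rfl, (d :: ·) '' s ∪ t, (hs.image_cons d).union_side e ht.1 ?_, ?_, ?_⟩
    · rintro _ ⟨x, _, rfl⟩ y hy
      exact ht.2 y hy x
    · rw [hsplit, hst, Set.image_union, Set.image_image, Set.union_comm t]
      rw [Set.union_right_comm]
      rfl
    · rintro _ (⟨x, hx, rfl⟩ | hx) z
      · exact sideLT_cons.2 (h x hx z)
      · exact ht.2 _ hx _

/-- The path is eventually periodic. One turn of its period gives an equation to which
`of_eq_union_append` applies, and the finite initial segment contributes one more summand. -/
theorem finiteDescriptionOn_exit (hC : ∀ p ∈ C, ∃ c, M.Stays C c p)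
    (hfd : ∀ p ∈ C, ∀ c p', M.step p c = some p' → p' ∉ C →
      FiniteDescriptionOn (M.languageFrom p')) (e : Bool) {p : M.State} (hp : p ∈ C) :
    FiniteDescriptionOn {w | M.Exit C e p w} := by
  have := M.finite
  choose! F hF using fun p (hp : p ∈ C) => stays_direction hC (e := e) hp
  have hCn : ∀ n, F^[n] p ∈ C := fun n => by
    induction n with
    | zero => exact hp
    | succ n ih => rw [Function.iterate_succ_apply']; exact (hF _ ih).1
  -- Pigeonhole: the path visits some state twice, at times `i < j`, so `j - i` is a period from
  -- time `i` on.
  obtain ⟨i, j, hij, h⟩ := Finite.exists_ne_map_eq_of_infinite fun n => F^[n] p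
  wlog hlt : i < j generalizing i j
  · exact this j i hij.symm h.symm (by omega)
  have hper : FiniteDescriptionOn {w | M.Exit C e (F^[i] p) w} := by
    obtain ⟨u, hu, s, hs, hst, hlt'⟩ := exit_eq_union hfd e hF (j - i) _ (hCn i)
    rw [← Function.iterate_add_apply, Nat.sub_add_cancel hlt.le, ← h] at hst
    exact .of_eq_union_append e (by rintro rfl; simp at hu; omega) hs hst hlt'
  obtain ⟨u, hu, s, hs, hst, hlt'⟩ := exit_eq_union hfd e hF i _ hp
  rw [hst, Set.union_comm]
  refine (hper.image_append u).union_side e hs ?_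
  rintro _ ⟨x, _, rfl⟩ y hy
  exact hlt' y hy x

theorem finiteDescriptionOn_block (hC : ∀ p ∈ C, ∃ c, M.Stays C c p)
    (hfd : ∀ p ∈ C, ∀ c p', M.step p c = some p' → p' ∉ C →
      FiniteDescriptionOn (M.languageFrom p')) {p : M.State} (hp : p ∈ M.branching C) :
    FiniteDescriptionOn (M.block C p) := by
  obtain ⟨p₀, hp₀, h0⟩ := hp.2 false
  obtain ⟨p₁, hp₁, h1⟩ := hp.2 true
  have : M.block C p = ((false :: ·) '' {w | M.Exit C true p₀ w} ∪ {w | w = [] ∧ p ∈ M.accept}) ∪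
      (true :: ·) '' {w | M.Exit C false p₁ w} := by
    ext w
    simp [block, h0, h1, or_assoc, eq_comm]
  rw [this]
  refine (((finiteDescriptionOn_exit hC hfd true hp₀).image_cons false).union
    (.sep_singleton _ _) ?_).union ((finiteDescriptionOn_exit hC hfd false hp₁).image_cons true) ?_
  · rintro _ ⟨x, _, rfl⟩ _ ⟨rfl, -⟩
    exact inorderVal_false_neg x
  · rintro _ (⟨x, _, rfl⟩ | ⟨rfl, -⟩) _ ⟨y, _, rfl⟩
    · exact inorderVal_false_lt_true x y
    · exact inorderVal_true_pos y

theorem stays_not_of_not_stays (hC : ∀ p ∈ C, ∃ c, M.Stays C c p) {p : M.State}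
    (hp : p ∈ C) {e : Bool} (h : ¬ M.Stays C e p) : M.Stays C (!e) p := by
  rw [← direction_of_not_stays h]
  exact stays_direction hC hp

/-- Every word accepted from a state of `C` either leaves one of the two outermost paths to the
outside or belongs to the block of a branching node. -/
theorem mem_languageFrom_iff {q : M.State} (hq : q ∈ C)
    {w : List Bool} : w ∈ M.languageFrom q ↔ M.Exit C false q w ∨
      (∃ x, ∃ p ∈ M.branching C, M.run q x = some p ∧ ∃ v ∈ M.block C p, w = x ++ v) ∨
      M.Exit C true q w := by
  constructor
  · intro hw
    induction w generalizing q with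
    | nil =>
      have hacc := (M.nil_mem_languageFrom).1 hw
      by_cases h0 : M.Stays C false q
      · by_cases h1 : M.Stays C true q
        · exact Or.inr (Or.inl ⟨[], q, ⟨hq, Bool.rec h0 h1⟩, rfl, [], Or.inr (Or.inl ⟨rfl, hacc⟩),
            rfl⟩)
        · exact Or.inr (Or.inr (.here h1 hacc))
      · exact Or.inl (.here h0 hacc)
    | cons c w ih =>
      obtain ⟨p, hp, hpw⟩ := (M.cons_mem_languageFrom).1 hw
      by_cases hpC : p ∈ C
      · have hst : M.Stays C c q := ⟨p, hpC, hp⟩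
        rcases ih hpC hpw with h | ⟨x, p', hp', hx, v, hv, rfl⟩ | h
        · by_cases hd : M.direction C false q = c
          · exact Or.inl (hd ▸ .stay (hd ▸ hp) h)
          · cases c
            · exact absurd (direction_of_stays hst) hd
            · have h0 : M.Stays C false q := by
                by_contra h0
                exact hd (direction_of_not_stays h0)
              exact Or.inr (Or.inl ⟨[], q, ⟨hq, Bool.rec h0 hst⟩, rfl, true :: w,
                Or.inr (Or.inr ⟨p, hp, w, h, rfl⟩), rfl⟩)
        · exact Or.inr (Or.inl ⟨c :: x, p', hp', by rw [run_cons M hp, hx], v, hv, rfl⟩)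
        · by_cases hd : M.direction C true q = c
          · exact Or.inr (Or.inr (hd ▸ .stay (hd ▸ hp) h))
          · cases c
            · have h1 : M.Stays C true q := by
                by_contra h1
                exact hd (direction_of_not_stays h1)
              exact Or.inr (Or.inl ⟨[], q, ⟨hq, Bool.rec hst h1⟩, rfl, false :: w,
                Or.inl ⟨p, hp, w, h, rfl⟩, rfl⟩)
            · exact absurd (direction_of_stays hst) hd
      · have hst : ¬ M.Stays C c q := by
          rintro ⟨p', hp', h⟩
          rw [hp, Option.some.injEq] at h
          exact hpC (h ▸ hp')
        cases c
        · exact Or.inl (.leave hst hp hpw)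
        · exact Or.inr (Or.inr (.leave hst hp hpw))
  · rintro (h | ⟨x, p, hp, hx, v, hv, rfl⟩ | h)
    · exact h.mem_languageFrom
    · exact (M.append_mem_languageFrom hx).2 (mem_languageFrom_of_mem_block hv)
    · exact h.mem_languageFrom

/-- Where only one direction stays in `C`, both outer paths take it; where both stay, the paths part
in the correct order. A word leaving either path leaves it on the outer side, so it is separated
from the other path as well. -/
theorem exit_false_lt_exit_true (hC : ∀ p ∈ C, ∃ c, M.Stays C c p) {q : M.State} (hq : q ∈ C)
    {v w : List Bool} (hv : M.Exit C false q v) (hw : M.Exit C true q w) :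
    inorderVal v < inorderVal w := by
  induction hv generalizing w with
  | @here p h _ =>
    have h' : M.Stays C true _ := stays_not_of_not_stays hC hq h
    rcases exit_iff.1 hw with ⟨h1, -⟩ | ⟨p', h1, x, h2, rfl⟩
    · exact absurd h' h1
    · rw [direction_of_stays h']
      exact inorderVal_true_pos x
  | @leave p _ v h _ _ =>
    have h' : M.Stays C true _ := stays_not_of_not_stays hC hq h
    rcases exit_iff.1 hw with ⟨h1, -⟩ | ⟨p', h1, x, h2, rfl⟩
    · exact absurd h' h1
    · rw [direction_of_stays h']
      exact inorderVal_false_lt_true v x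
  | @stay p p₁ v hp₁ hv ih =>
    have hp₁C : p₁ ∈ C := by
      obtain ⟨p₂, h2, h3⟩ := stays_direction hC (e := false) hq
      rw [hp₁, Option.some.injEq] at h3
      exact h3 ▸ h2
    by_cases h0 : M.Stays C false p
    · rw [direction_of_stays h0] at hp₁ ⊢
      rcases exit_iff.1 hw with ⟨h1, ⟨rfl, _⟩ | ⟨p', h2, x, h3, rfl⟩⟩ | ⟨p', h1, x, h2, rfl⟩
      · exact inorderVal_false_neg v
      · exact inorderVal_false_lt_true v x
      · cases hd : M.direction C true p
        · rw [hd, hp₁, Option.some.injEq] at h1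
          exact inorderVal_cons_lt_cons.2 (ih hp₁C (h1 ▸ h2))
        · exact inorderVal_false_lt_true v x
    · have h' : M.Stays C true _ := stays_not_of_not_stays hC hq h0
      rw [direction_of_not_stays h0] at hp₁ ⊢
      rcases exit_iff.1 hw with ⟨h1, -⟩ | ⟨p', h1, x, h2, rfl⟩
      · exact absurd h' h1
      · rw [direction_of_stays h', show true = !false from rfl, hp₁, Option.some.injEq] at h1
        rw [direction_of_stays h']
        exact inorderVal_cons_lt_cons.2 (ih hp₁C (h1 ▸ h2))

theorem sideLT_exit (hC : ∀ p ∈ C, ∃ c, M.Stays C c p) {q : M.State} (hq : q ∈ C) (e : Bool)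
    {v w : List Bool} (hv : M.Exit C (!e) q v) (hw : M.Exit C e q w) : SideLT e v w := by
  cases e
  · exact exit_false_lt_exit_true hC hq hw hv
  · exact exit_false_lt_exit_true hC hq hv hw

/-- The half of a block on the side `e` consists of words beginning with `e`; the rest of the block
precedes, as seen from the other side, every word beginning with `e`. -/
theorem block_cases {p : M.State} {v : List Bool} (hv : v ∈ M.block C p) (e : Bool) :
    (∃ p', M.step p e = some p' ∧ ∃ x, M.Exit C (!e) p' x ∧ v = e :: x) ∨
      ∀ z, SideLT e v (e :: z) := by
  rcases hv with ⟨p', h1, x, h2, rfl⟩ | ⟨rfl, -⟩ | ⟨p', h1, x, h2, rfl⟩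
  · cases e
    · exact Or.inl ⟨p', h1, x, h2, rfl⟩
    · exact Or.inr fun z => sideLT_not_cons_cons true x z
  · exact Or.inr fun z => sideLT_nil_cons e z
  · cases e
    · exact Or.inr fun z => sideLT_not_cons_cons false x z
    · exact Or.inl ⟨p', h1, x, h2, rfl⟩

/-- By `hconv` a path to a branching node never leaves `C`, so it cannot pass beyond the `e`-most
path. If the node lies on that path, `block_cases` reduces the claim to the comparison of the two
kinds of exits. -/
theorem sideLT_exit_of_block (hC : ∀ p ∈ C, ∃ c, M.Stays C c p)
    (hconv : ∀ p ∈ C, ∀ c p' x p'', M.step p c = some p' → M.run p' x = some p'' → p'' ∈ C →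
      p' ∈ C) {q : M.State} (hq : q ∈ C) {e : Bool} {v w x : List Bool} {p : M.State}
    (hw : M.Exit C e q w) (hp : p ∈ M.branching C) (hx : M.run q x = some p)
    (hv : v ∈ M.block C p) : SideLT e (x ++ v) w := by
  -- At a state with no `e`-edge inside `C`, a path to a branching node must continue in the
  -- direction `!e`.
  have hne : ∀ q ∈ C, ∀ x, M.run q x = some p → ¬ M.Stays C e q →
      ∃ x' q', q' ∈ C ∧ x = (!e) :: x' ∧ M.step q (!e) = some q' ∧ M.run q' x' = some p := by
    intro q hq x hx h
    rcases x with _ | ⟨c, x⟩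
    · simp only [run, Option.some.injEq] at hx
      exact absurd (hp.2 e) (hx ▸ h)
    · obtain ⟨q', hq', hx'⟩ := Option.bind_eq_some_iff.1 hx
      have hq'C := hconv q hq c q' x p hq' hx' hp.1
      rcases Bool.eq_or_eq_not c e with rfl | rfl
      · exact absurd ⟨q', hq'C, hq'⟩ h
      · exact ⟨x, q', hq'C, rfl, hq', hx'⟩
  induction hw generalizing x with
  | here h _ =>
    obtain ⟨x', _, _, rfl, _⟩ := hne _ hq x hx h
    exact sideLT_not_cons_nil _ _
  | leave h _ _ =>
    obtain ⟨x', _, _, rfl, _⟩ := hne _ hq x hx h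
    exact sideLT_not_cons_cons _ _ _
  | @stay q q₁ w hq₁ hw ih =>
    have hq₁C : q₁ ∈ C := by
      obtain ⟨p₂, h2, h3⟩ := stays_direction hC (e := e) hq
      rw [hq₁, Option.some.injEq] at h3
      exact h3 ▸ h2
    by_cases h : M.Stays C e q
    · rw [direction_of_stays h] at hq₁ ⊢
      rcases x with _ | ⟨c, x⟩
      · simp only [run, Option.some.injEq] at hx
        subst hx
        rcases block_cases hv e with ⟨p', h1, x, h2, rfl⟩ | h'
        · rw [hq₁, Option.some.injEq] at h1
          exact sideLT_cons.2 (sideLT_exit hC hq₁C e (h1 ▸ h2) hw)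
        · exact h' w
      · obtain ⟨q', hq', hx'⟩ := Option.bind_eq_some_iff.1 hx
        rcases Bool.eq_or_eq_not c e with rfl | rfl
        · rw [hq₁, Option.some.injEq] at hq'
          exact sideLT_cons.2 (ih hq₁C (hq' ▸ hx'))
        · exact sideLT_not_cons_cons _ _ _
    · obtain ⟨x', q', _, rfl, h1, hx'⟩ := hne _ hq x hx h
      rw [direction_of_not_stays h] at hq₁ ⊢
      rw [hq₁, Option.some.injEq] at h1
      exact sideLT_cons.2 (ih hq₁C (h1 ▸ hx'))

/-- Common letters are cancelled. If neither node is above the other, the diverging letters decide.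
If one is above the other, the block of the lower node lies strictly within the outer exits of a
subtree of the upper one, by `sideLT_exit_of_block`. -/
theorem block_lt_block (hC : ∀ p ∈ C, ∃ c, M.Stays C c p)
    (hconv : ∀ p ∈ C, ∀ c p' x p'', M.step p c = some p' → M.run p' x = some p'' → p'' ∈ C →
      p' ∈ C) {q : M.State} (hq : q ∈ C) {x y v w : List Bool} {p p' : M.State}
    (hp : p ∈ M.branching C) (hp' : p' ∈ M.branching C) (hx : M.run q x = some p)
    (hy : M.run q y = some p') (h : inorderVal x < inorderVal y) (hv : v ∈ M.block C p)
    (hw : w ∈ M.block C p') : inorderVal (x ++ v) < inorderVal (y ++ w) := by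
  induction x generalizing q y with
  | nil =>
    simp only [run, Option.some.injEq] at hx
    subst hx
    rcases y with _ | ⟨_ | _, y⟩
    · exact absurd h (lt_irrefl _)
    · exact absurd h (inorderVal_false_neg y).not_gt
    · obtain ⟨q', hq', hy'⟩ := Option.bind_eq_some_iff.1 hy
      have hq'C := hconv q hq _ q' y p' hq' hy' hp'.1
      rcases block_cases hv true with ⟨q₁, h1, z, hz, rfl⟩ | h'
      · rw [hq', Option.some.injEq] at h1
        exact inorderVal_cons_lt_cons.2
          (sideLT_exit_of_block (e := false) hC hconv hq'C (h1 ▸ hz) hp' hy' hw)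
      · exact h' _
  | cons c x ih =>
    obtain ⟨q', hq', hx'⟩ := Option.bind_eq_some_iff.1 hx
    have hq'C := hconv q hq _ q' x p hq' hx' hp.1
    rcases y with _ | ⟨d, y⟩
    · simp only [run, Option.some.injEq] at hy
      subst hy
      cases c
      · rcases block_cases hw false with ⟨q₁, h1, z, hz, rfl⟩ | h'
        · rw [hq', Option.some.injEq] at h1
          exact inorderVal_cons_lt_cons.2
            (sideLT_exit_of_block (e := true) hC hconv hq'C (h1 ▸ hz) hp hx' hv)
        · exact h' _
      · exact absurd h (inorderVal_true_pos x).not_gt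
    · by_cases hcd : c = d
      · subst hcd
        refine inorderVal_cons_lt_cons.2 (ih hq'C hx' ?_ (inorderVal_cons_lt_cons.1 h))
        rwa [run_cons M hq'] at hy
      · cases c <;> cases d <;> simp at hcd
        · exact inorderVal_false_lt_true _ _
        · exact absurd h (inorderVal_false_lt_true y x).not_gt

/-- From left to right the language consists of the left exits, the blocks of the branching nodes,
and the right exits. The middle part is empty or a shuffle, coloured by the branching states. -/
theorem finiteDescriptionOn_of_component (hC : ∀ p ∈ C, ∃ c, M.Stays C c p)
    (hconv : ∀ p ∈ C, ∀ c p' x p'', M.step p c = some p' → M.run p' x = some p'' → p'' ∈ C →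
      p' ∈ C)
    (hconn : ∀ p ∈ C, ∀ p' ∈ C, ∃ x, M.run p x = some p')
    (hfd : ∀ p ∈ C, ∀ c p', M.step p c = some p' → p' ∉ C →
      FiniteDescriptionOn (M.languageFrom p')) {q : M.State} (hq : q ∈ C) :
    FiniteDescriptionOn (M.languageFrom q) := by
  have := M.finite
  set D : Set (List Bool) := {w | ∃ x, ∃ p ∈ M.branching C, M.run q x = some p ∧
    ∃ v ∈ M.block C p, w = x ++ v}
  have hD : FiniteDescriptionOn D := by
    rcases (M.branching C).eq_empty_or_nonempty with hB | ⟨p₀, hp₀⟩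
    · have : D = ∅ := by ext w; simp [D, hB]
      rw [this]
      exact .empty
    · let N : Set (List Bool) := {x | ∃ p ∈ M.branching C, M.run q x = some p}
      have hN : ∀ x : N, ∃ p : M.branching C, M.run q x = some p.1 := by
        rintro ⟨x, p, hp, hx⟩
        exact ⟨⟨p, hp⟩, hx⟩
      choose c hc using hN
      -- Both edges of a branching node stay in `C`, and strong connectedness leads from there to
      -- any prescribed branching state.
      have hextend : ∀ (x : N) (d : Bool) (k : M.branching C), ∃ z, ∃ y : N,
          y.1 = x ++ d :: z ∧ c y = k := by
        intro x d k
        obtain ⟨p', hp', h⟩ := (c x).2.2 d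
        obtain ⟨z, hz⟩ := hconn p' hp' k.1 k.2.1
        have hrun : M.run q (x ++ d :: z) = some k.1 := by
          rw [run_append, hc, Option.bind_some, run_cons M h, hz]
        refine ⟨z, ⟨x ++ d :: z, k, k.2, hrun⟩, rfl, Subtype.ext ?_⟩
        exact Option.some_injective _ ((hc _).symm.trans hrun)
      have hlt : ∀ (x : List Bool) z, inorderVal (x ++ false :: z) < inorderVal x := fun x z => by
        conv_rhs => rw [← List.append_nil x]
        exact inorderVal_append_lt_append.2 (inorderVal_false_neg z)
      have hgt : ∀ (x : List Bool) z, inorderVal x < inorderVal (x ++ true :: z) := fun x z => by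
        conv_lhs => rw [← List.append_nil x]
        exact inorderVal_append_lt_append.2 (inorderVal_true_pos z)
      have key := FiniteDescriptionOn.iUnion_dense (B := M.branching C) (N := N)
        (b := fun k => M.block C k) (fun k => finiteDescriptionOn_block hC hfd k.2) c ?_ ?_ ?_ ?_ ?_
      · convert key using 1
        ext w
        constructor
        · rintro ⟨x, p, hp, hx, v, hv, rfl⟩
          refine ⟨⟨x, p, hp, hx⟩, v, ?_, rfl⟩
          rwa [← Option.some_injective _ (hx.symm.trans (hc ⟨x, p, hp, hx⟩))]
        · rintro ⟨x, v, hv, rfl⟩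
          exact ⟨x, c x, (c x).2, hc x, v, hv, rfl⟩
      · obtain ⟨x, hx⟩ := hconn q hq p₀ hp₀.1
        exact ⟨x, p₀, hp₀, hx⟩
      · intro x k
        obtain ⟨z, y, hy, hk⟩ := hextend x false k
        exact ⟨y, hk, hy ▸ hlt _ _⟩
      · intro x k
        obtain ⟨z, y, hy, hk⟩ := hextend x true k
        exact ⟨y, hk, hy ▸ hgt _ _⟩
      · intro x y hxy k
        -- A node between the two is found below one of them: to the left of `y` if `x` is a prefix
        -- of `y`, and to the right of `x` otherwise.
        by_cases hpre : x.1 <+: y.1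
        · obtain ⟨z, u, hu, hk⟩ := hextend y false k
          refine ⟨u, hk, hu ▸ inorderVal_lt_append _ hxy fun h => ?_, hu ▸ hlt _ _⟩
          rw [hpre.eq_of_length_le h.length_le] at hxy
          exact lt_irrefl _ hxy
        · obtain ⟨z, u, hu, hk⟩ := hextend x true k
          exact ⟨u, hk, hu ▸ hgt _ _, hu ▸ inorderVal_append_lt _ hxy hpre⟩
      · intro x y hxy v hv w hw
        exact block_lt_block hC hconv hq (c x).2 (c y).2 (hc x) (hc y) hxy hv hw
  have hsplit : M.languageFrom q = ({w | M.Exit C false q w} ∪ D) ∪ {w | M.Exit C true q w} := by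
    ext w
    rw [mem_languageFrom_iff hq, ← or_assoc]
    rfl
  rw [hsplit]
  refine ((finiteDescriptionOn_exit hC hfd false hq).union hD ?_).union
    (finiteDescriptionOn_exit hC hfd true hq) ?_
  · rintro w hw _ ⟨x, p, hp, hx, v, hv, rfl⟩
    exact sideLT_exit_of_block (e := false) hC hconv hq hw hp hx hv
  · rintro _ (hv | ⟨x, p, hp, hx, v, hv, rfl⟩) w hw
    · exact exit_false_lt_exit_true hC hq hv hw
    · exact sideLT_exit_of_block (e := true) hC hconv hq hw hp hx hv

end Component

/-! ### Induction over the reachable states -/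

theorem finiteDescriptionOn_of_step {q : M.State}
    (h : ∀ c p, M.step q c = some p → FiniteDescriptionOn (M.languageFrom p)) :
    FiniteDescriptionOn (M.languageFrom q) := by
  have hsplit : M.languageFrom q =
      ({w | ∃ p, M.step q false = some p ∧ ∃ x ∈ M.languageFrom p, w = false :: x} ∪
        {w | w = [] ∧ q ∈ M.accept}) ∪
      {w | ∃ p, M.step q true = some p ∧ ∃ x ∈ M.languageFrom p, w = true :: x} := by
    ext w
    rcases w with _ | ⟨_ | _, w⟩ <;>
      simp [nil_mem_languageFrom, cons_mem_languageFrom]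
  rw [hsplit]
  refine ((M.finiteDescriptionOn_cons (h false)).union (.sep_singleton _ _) ?_).union
    (M.finiteDescriptionOn_cons (h true)) ?_
  · rintro _ ⟨_, _, x, _, rfl⟩ _ ⟨rfl, -⟩
    exact inorderVal_false_neg x
  · rintro _ (⟨_, _, x, _, rfl⟩ | ⟨rfl, -⟩) _ ⟨_, _, y, _, rfl⟩
    · exact inorderVal_false_lt_true x y
    · exact inorderVal_true_pos y

/-- The words accepted from a state of a finite automaton form a finite description linear
order. -/
theorem finiteDescriptionOn_languageFrom (q : M.State) :
    FiniteDescriptionOn (M.languageFrom q) := by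
  have := M.finite
  let R : M.State → Set M.State := fun p => {p' | ∃ x, M.run p x = some p'}
  have hself : ∀ p, p ∈ R p := fun p => ⟨[], rfl⟩
  have htrans : ∀ {a b c}, b ∈ R a → c ∈ R b → c ∈ R a := by
    rintro a b c ⟨x, hx⟩ ⟨y, hy⟩
    exact ⟨x ++ y, by rw [run_append, hx, Option.bind_some, hy]⟩
  have hstep : ∀ {a b c}, M.step a c = some b → b ∈ R a := fun {a b c} h =>
    ⟨[c], by rw [run_cons M h]; rfl⟩
  induction hn : (R q).ncard using Nat.strong_induction_on generalizing q with
  | _ n ih =>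
    -- A reachable state that cannot return to `q` reaches strictly fewer states, since `q` itself
    -- is lost.
    have hsmall : ∀ p ∈ R q, q ∉ R p → FiniteDescriptionOn (M.languageFrom p) := by
      intro p hp hq
      refine ih _ (hn ▸ Set.ncard_lt_ncard ⟨fun r hr => htrans hp hr, fun h => ?_⟩) p rfl
      exact hq (h (hself q))
    by_cases hloop : ∃ c p, M.step q c = some p ∧ q ∈ R p
    · obtain ⟨c₀, p₀, h₀, hq₀⟩ := hloop
      refine finiteDescriptionOn_of_component (C := {p | p ∈ R q ∧ q ∈ R p}) ?_ ?_ ?_ ?_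
        ⟨hself q, hself q⟩
      · rintro p ⟨hp, x, hx⟩
        rcases x with _ | ⟨c, x⟩
        · simp only [run, Option.some.injEq] at hx
          subst hx
          exact ⟨c₀, p₀, ⟨hstep h₀, hq₀⟩, h₀⟩
        · obtain ⟨p', hp', hx'⟩ := Option.bind_eq_some_iff.1 hx
          exact ⟨c, p', ⟨htrans hp (hstep hp'), x, hx'⟩, hp'⟩
      · rintro p ⟨hp, -⟩ c p' x p'' hp' hx hp''
        exact ⟨htrans hp (hstep hp'), htrans ⟨x, hx⟩ hp''.2⟩
      · rintro p ⟨-, hp⟩ p' ⟨hp', -⟩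
        exact htrans hp hp'
      · rintro p ⟨hp, -⟩ c p' hp' hC
        have hqp' := htrans hp (hstep hp')
        exact hsmall p' hqp' fun h => hC ⟨hqp', h⟩
    · push Not at hloop
      exact M.finiteDescriptionOn_of_step fun c p h => hsmall p (hstep h) (hloop c p h)

end PartialDFA

/-! ## Universal solutions of word problems -/

namespace Arrangement

variable {Γ : Type} {U : Type u} {A B C : U → Arrangement.{u} Γ}

/-- The identity morphism. -/
def Hom.id (A : Arrangement.{u} Γ) : Hom A A := ⟨RelEmbedding.refl _, fun _ => rfl⟩

/-- The composition of morphisms. -/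
def Hom.comp {A B C : Arrangement.{u} Γ} (g : Hom B C) (f : Hom A B) : Hom A C :=
  ⟨f.toRelEmbedding.trans g.toRelEmbedding, fun x => (g.color_eq _).trans (f.color_eq x)⟩

theorem Hom.ext {A B : Arrangement.{u} Γ} {f g : Hom A B}
    (h : ∀ x, f.toRelEmbedding x = g.toRelEmbedding x) : f = g := by
  obtain ⟨f, _⟩ := f
  obtain ⟨g, _⟩ := g
  congr
  exact RelEmbedding.ext h

theorem evalMap_id (c : Γ ⊕ U) (x : (eval A c).carrier) :
    evalMap (fun v => Hom.id (A v)) c x = x := by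
  cases c <;> rfl

theorem evalMap_comp (g : ∀ v, Hom (B v) (C v)) (f : ∀ v, Hom (A v) (B v)) (c : Γ ⊕ U)
    (x : (eval A c).carrier) :
    evalMap (fun v => (g v).comp (f v)) c x = evalMap g c (evalMap f c x) := by
  cases c <;> rfl

/-- A rank on the components of a family, extended to letters by zero. -/
def evalRank (d : ∀ v, (A v).carrier → ℕ) : ∀ c : Γ ⊕ U, (eval A c).carrier → ℕ
  | .inl _, _ => 0
  | .inr v, x => d v x

/-- The action of a family of maps, defined on elements of rank less than `n`, on the arrangements
substituted for a letter or an unknown. -/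
def evalLift (d : ∀ v, (A v).carrier → ℕ) {n : ℕ}
    (f : ∀ v x, d v x < n → (B v).carrier) :
    ∀ (c : Γ ⊕ U) (x : (eval A c).carrier), evalRank d c x < n → (eval B c).carrier
  | .inl _, x, _ => x
  | .inr v, x, h => f v x h

/-- The action of a family of maps on the arrangements substituted for a letter or an unknown. -/
def evalFun (f : ∀ v, (A v).carrier → (B v).carrier) :
    ∀ c : Γ ⊕ U, (eval A c).carrier → (eval B c).carrier
  | .inl _, x => x
  | .inr v, x => f v x

theorem evalLift_eq_evalFun {d : ∀ v, (A v).carrier → ℕ} {n : ℕ}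
    (f : ∀ v, (A v).carrier → (B v).carrier) (c : Γ ⊕ U) (x : (eval A c).carrier)
    (h : evalRank d c x < n) : evalLift d (fun v x _ => f v x) c x h = evalFun f c x := by
  cases c <;> rfl

theorem evalMap_eq_evalFun (f : ∀ v, Hom (A v) (B v)) (c : Γ ⊕ U) (x : (eval A c).carrier) :
    evalMap f c x = evalFun (fun v x => (f v).toRelEmbedding x) c x := by
  cases c <;> rfl

theorem evalFun_congr {d : ∀ v, (A v).carrier → ℕ} {n : ℕ}
    {f g : ∀ v, (A v).carrier → (B v).carrier} (h : ∀ v x, d v x < n → f v x = g v x)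
    (c : Γ ⊕ U) (x : (eval A c).carrier) (hx : evalRank d c x < n) :
    evalFun f c x = evalFun g c x := by
  cases c with
  | inl _ => rfl
  | inr v => exact h v x hx

theorem evalFun_lt {d : ∀ v, (A v).carrier → ℕ} {n : ℕ}
    {f : ∀ v, (A v).carrier → (B v).carrier}
    (h : ∀ v x y, d v x < n → (A v).lt x y → (B v).lt (f v x) (f v y))
    (c : Γ ⊕ U) (x y : (eval A c).carrier) (hx : evalRank d c x < n) (hxy : (eval A c).lt x y) :
    (eval B c).lt (evalFun f c x) (evalFun f c y) := by
  cases c with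
  | inl _ => exact hxy.elim
  | inr v => exact h v x y hx hxy

theorem evalFun_color {d : ∀ v, (A v).carrier → ℕ} {n : ℕ}
    {f : ∀ v, (A v).carrier → (B v).carrier}
    (h : ∀ v x, d v x < n → (B v).color (f v x) = (A v).color x)
    (c : Γ ⊕ U) (x : (eval A c).carrier) (hx : evalRank d c x < n) :
    (eval B c).color (evalFun f c x) = (eval A c).color x := by
  cases c with
  | inl _ => rfl
  | inr v => exact h v x hx

theorem substMap_id (w : List (Γ ⊕ U)) (x : (subst A w).carrier) :
    substMap (fun v => Hom.id (A v)) w x = x :=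
  Sigma.ext rfl (heq_of_eq (evalMap_id _ _))

theorem substMap_comp (g : ∀ v, Hom (B v) (C v)) (f : ∀ v, Hom (A v) (B v))
    (w : List (Γ ⊕ U)) (x : (subst A w).carrier) :
    substMap (fun v => (g v).comp (f v)) w x = substMap g w (substMap f w x) :=
  Sigma.ext rfl (heq_of_eq (evalMap_comp _ _ _ _))

end Arrangement

namespace WordProblem

open Arrangement

variable {Γ : Type} {U : Type u} {W : WordProblem Γ U}

theorem IsSolutionHom.id (S : Solution W) : IsSolutionHom S S fun v => Hom.id (S.arr v) := by
  intro v x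
  exact (substMap_id _ _).symm

theorem IsSolutionHom.comp {S T R : Solution W} {g : ∀ v, Hom (T.arr v) (R.arr v)}
    {f : ∀ v, Hom (S.arr v) (T.arr v)} (hg : IsSolutionHom T R g) (hf : IsSolutionHom S T f) :
    IsSolutionHom S R fun v => (g v).comp (f v) := by
  intro v x
  rw [substMap_comp, ← hf v x]
  exact hg v _

/-- The two morphisms given by initiality compose to endomorphisms, which are identities by
uniqueness. -/
theorem Solution.IsUniversal.nonempty_relIso {S T : Solution W} (hS : S.IsUniversal)
    (hT : T.IsUniversal) (v : U) : Nonempty ((S.arr v).lt ≃r (T.arr v).lt) := by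
  obtain ⟨f, hf, -⟩ := hS T
  obtain ⟨g, hg, -⟩ := hT S
  have hgf := (hS S).unique (hg.comp hf) (.id S)
  have hfg := (hT T).unique (hf.comp hg) (.id T)
  refine ⟨⟨⟨(f v).toRelEmbedding, (g v).toRelEmbedding, fun x => ?_, fun x => ?_⟩,
    (f v).toRelEmbedding.map_rel_iff⟩⟩
  · exact congrArg (fun h => (h v).toRelEmbedding x) hgf
  · exact congrArg (fun h => (h v).toRelEmbedding x) hfg

/-! ### Solutions with a rank decreasing under unfolding are initial -/

namespace Solution

variable (S T : Solution W) (d : ∀ v, (S.arr v).carrier → ℕ)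
  (hd : ∀ v x, evalRank d _ ((S.iso v).toRelIso x).2 < d v x)

/-- The map between the components of two solutions that is defined by recursion on a rank that
decreases under unfolding. -/
noncomputable def lift : ∀ p : Σ v, (S.arr v).carrier, (T.arr p.1).carrier :=
  (measure fun p : Σ v, (S.arr v).carrier => d p.1 p.2).wf.fix fun p f =>
    (T.iso p.1).toRelIso.symm ⟨((S.iso p.1).toRelIso p.2).1,
      evalLift d (fun v x h => f ⟨v, x⟩ h) _ ((S.iso p.1).toRelIso p.2).2 (hd p.1 p.2)⟩

theorem iso_lift (v : U) (x : (S.arr v).carrier) :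
    (T.iso v).toRelIso (lift S T d hd ⟨v, x⟩) = ⟨((S.iso v).toRelIso x).1,
      evalFun (fun v x => lift S T d hd ⟨v, x⟩) _ ((S.iso v).toRelIso x).2⟩ := by
  have h : lift S T d hd ⟨v, x⟩ = (T.iso v).toRelIso.symm ⟨((S.iso v).toRelIso x).1,
      evalLift d (fun v x _ => lift S T d hd ⟨v, x⟩) _ ((S.iso v).toRelIso x).2 (hd v x)⟩ :=
    WellFounded.fix_eq _ _ _
  rw [h]
  refine (RelIso.apply_symm_apply _ _).trans (congrArg _ ?_)
  exact (evalLift_eq_evalFun (fun v x => lift S T d hd ⟨v, x⟩) _ _ (hd v x))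

/-- Elements that unfold into different entries are compared by position, which the map preserves.
Within one entry the rank of the left element has dropped, and this is all that the induction needs.
-/
theorem lift_lt {v : U} {x y : (S.arr v).carrier} (h : (S.arr v).lt x y) :
    (T.arr v).lt (lift S T d hd ⟨v, x⟩) (lift S T d hd ⟨v, y⟩) := by
  induction hn : d v x using Nat.strong_induction_on generalizing v with
  | _ n ih =>
    subst hn
    rw [← (T.iso v).toRelIso.map_rel_iff, iso_lift, iso_lift]
    rw [← (S.iso v).toRelIso.map_rel_iff] at h
    have hx := hd v x
    revert h hx
    generalize d v x = n at ih
    generalize (S.iso v).toRelIso x = a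
    generalize (S.iso v).toRelIso y = b
    intro h hx
    rcases h with ⟨a', b', h⟩ | ⟨a', b', h⟩
    · exact Sigma.Lex.left _ _ h
    · exact Sigma.Lex.right _ _
        (evalFun_lt (d := d) (fun p x y hx h => ih _ hx h rfl) _ _ _ hx h)

theorem color_lift (v : U) (x : (S.arr v).carrier) :
    (T.arr v).color (lift S T d hd ⟨v, x⟩) = (S.arr v).color x := by
  induction hn : d v x using Nat.strong_induction_on generalizing v with
  | _ n ih =>
    subst hn
    rw [← (T.iso v).color_eq, iso_lift, ← (S.iso v).color_eq]
    exact evalFun_color (d := d) (fun p x hx => ih _ hx p x rfl) _ _ (hd v x)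

/-- A solution with a rank that decreases under unfolding is universal. -/
theorem isUniversal_of_rank
    (hd : ∀ v x, evalRank d _ ((S.iso v).toRelIso x).2 < d v x) : S.IsUniversal := by
  intro T
  have := fun v => (S.arr v).isStrictTotalOrder
  have := fun v => (T.arr v).isStrictTotalOrder
  let F : ∀ v, Hom (S.arr v) (T.arr v) := fun v =>
    ⟨RelEmbedding.ofMonotone (fun x => lift S T d hd ⟨v, x⟩) fun _ _ h => lift_lt S T d hd h,
      color_lift S T d hd v⟩
  refine ⟨F, ?_, ?_⟩
  · intro v x
    refine (iso_lift S T d hd v x).trans ?_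
    exact congrArg _ (evalMap_eq_evalFun F _ _).symm
  · intro f hf
    refine funext fun v => Hom.ext fun x => ?_
    change (f v).toRelEmbedding x = lift S T d hd ⟨v, x⟩
    induction hn : d v x using Nat.strong_induction_on generalizing v with
    | _ n ih =>
      subst hn
      apply (T.iso v).toRelIso.injective
      rw [iso_lift]
      refine (hf v x).trans (congrArg _ ((evalMap_eq_evalFun _ _ _).trans ?_))
      exact evalFun_congr (d := d) (fun p x hx => ih _ hx p x rfl) _ _ (hd v x)

end Solution

end WordProblem

/-! ## The linguage as a universal solution -/

/-- The empty word, or the word `c x` for a direction `c`. -/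
def tagWord : Option Bool → List Bool → List Bool
  | none, _ => []
  | some c, x => c :: x

/-- The tag of an entry is the letter it contributes in front, or `none` for the star. With `w` a
variable, substitution settles the eight cases: accepting or not, and each successor present or
absent. -/
theorem exists_tag {U : Type u} (o : Bool → Option U) (P : Prop) [Decidable P]
    (w : List (Unit ⊕ U)) (hw : w = (o false).toList.map Sum.inr ++
      (if P then [Sum.inl ()] else []) ++ (o true).toList.map Sum.inr) :
    ∃ tag : Fin w.length → Option Bool,
      (∀ i g, w.get i = Sum.inl g → tag i = none ∧ P) ∧
      (∀ i p, w.get i = Sum.inr p → ∃ c, tag i = some c ∧ o c = some p) ∧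
      (∀ i j, i < j → ∀ x y,
        inorderVal (tagWord (tag i) x) < inorderVal (tagWord (tag j) y)) ∧
      (P → ∃ i, w.get i = Sum.inl () ∧ tag i = none) ∧
      ∀ c p, o c = some p → ∃ i, w.get i = Sum.inr p ∧ tag i = some c := by
  have h1 := fun x y => inorderVal_false_lt_true x y
  have h2 : ∀ x, inorderVal (false :: x) < inorderVal [] := inorderVal_false_neg
  have h3 : ∀ x, inorderVal [] < inorderVal (true :: x) := inorderVal_true_pos
  by_cases hP : P <;> rcases h0 : o false with _ | p₀ <;> rcases h1 : o true with _ | p₁ <;>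
    simp only [h0, h1, hP, if_true, if_false, Option.toList, List.map_nil, List.map_cons,
      List.nil_append, List.append_nil, List.cons_append] at hw <;> subst hw
  · refine ⟨![none], ?_⟩
    simp [tagWord, *]
  · refine ⟨![none, some true], ?_⟩
    simp [Fin.forall_fin_succ, Fin.exists_fin_succ, tagWord, *]
  · refine ⟨![some false, none], ?_⟩
    simp [Fin.forall_fin_succ, Fin.exists_fin_succ, tagWord, *]
  · refine ⟨![some false, none, some true], ?_⟩
    simp [Fin.forall_fin_succ, Fin.exists_fin_succ, tagWord, *]
  · refine ⟨![], ?_⟩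
    simp [*]
  · refine ⟨![some true], ?_⟩
    simp [tagWord, *]
  · refine ⟨![some false], ?_⟩
    simp [tagWord, *]
  · refine ⟨![some false, some true], ?_⟩
    simp [Fin.forall_fin_succ, Fin.exists_fin_succ, tagWord, *]

namespace PartialDFA

open Arrangement

variable (M : PartialDFA.{u} Bool)

/-- The words accepted from a state, as an arrangement. -/
def arrangement (q : M.State) : Arrangement.{u} Unit where
  carrier := ULift (M.languageFrom q)
  lt x y := InorderOn _ x.down y.down
  isStrictTotalOrder := (RelIso.preimage Equiv.ulift (InorderOn _)).toRelEmbedding.isStrictTotalOrder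
  color _ := ()

/-- A rank on the elements of the arrangements. -/
def arrangementRank (q : M.State) (x : (M.arrangement q).carrier) : ℕ :=
  -- The added one places the empty word above the letter it unfolds to, which has rank zero.
  (ULift.down x).1.length + 1

/-- The word that an element of a substituted letter or unknown stands for. -/
def entryWord : ∀ c : Unit ⊕ M.State, (eval M.arrangement c).carrier → List Bool
  | .inl _, _ => []
  | .inr _, x => x.down.1

theorem exists_subst_iso (q : M.State) :
    ∃ e : Arrangement.Iso (M.arrangement q) (subst M.arrangement (M.wordProblem q)),
      ∀ x, evalRank M.arrangementRank _ (e.toRelIso x).2 < M.arrangementRank q x := by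
  classical
  obtain ⟨tag, hl, hr, hlt, hsl, hsr⟩ := exists_tag (M.step q) (q ∈ M.accept) (M.wordProblem q) (by
    unfold wordProblem
    congr)
  let f : (subst M.arrangement (M.wordProblem q)).carrier → List Bool :=
    fun x => tagWord (tag x.1) (M.entryWord _ x.2)
  have hf : ∀ x, f x ∈ M.languageFrom q := by
    rintro ⟨i, x⟩
    change tagWord (tag i) (M.entryWord _ x) ∈ _
    revert x
    cases hc : (M.wordProblem q).get i with
    | inl g =>
      intro x
      rw [(hl i g hc).1]
      exact M.nil_mem_languageFrom.2 (hl i g hc).2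
    | inr p =>
      intro x
      obtain ⟨c, htag, hstep⟩ := hr i p hc
      rw [htag]
      exact M.cons_mem_languageFrom.2 ⟨p, hstep, x.down.2⟩
  have hmono : ∀ x y, (subst M.arrangement (M.wordProblem q)).lt x y →
      inorderVal (f x) < inorderVal (f y) := by
    rintro _ _ (⟨x, y, h⟩ | @⟨i, x, y, h⟩)
    · exact hlt _ _ h _ _
    · change inorderVal (tagWord (tag i) (M.entryWord _ x)) <
        inorderVal (tagWord (tag i) (M.entryWord _ y))
      revert x y
      cases hc : (M.wordProblem q).get i with
      | inl g => exact fun x y h => h.elim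
      | inr p =>
        intro x y h
        obtain ⟨c, htag, -⟩ := hr i p hc
        rw [htag]
        exact inorderVal_cons_lt_cons.2 h
  have hentry : ∀ {i c}, (M.wordProblem q).get i = c → ∀ y : (eval M.arrangement c).carrier,
      ∃ x, f x = tagWord (tag i) (M.entryWord c y) := by
    rintro i _ rfl y
    exact ⟨⟨i, y⟩, rfl⟩
  have hsurj : ∀ w ∈ M.languageFrom q, ∃ x, f x = w := by
    rintro (_ | ⟨c, w⟩) hw
    · obtain ⟨i, hi, htag⟩ := hsl (M.nil_mem_languageFrom.1 hw)
      obtain ⟨x, hx⟩ := hentry hi PUnit.unit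
      exact ⟨x, by rw [hx, htag]; rfl⟩
    · obtain ⟨p, hp, hw⟩ := M.cons_mem_languageFrom.1 hw
      obtain ⟨i, hi, htag⟩ := hsr c p hp
      obtain ⟨x, hx⟩ := hentry hi ⟨w, hw⟩
      exact ⟨x, by rw [hx, htag]; rfl⟩
  have := (subst M.arrangement (M.wordProblem q)).isStrictTotalOrder
  have := (M.arrangement q).isStrictTotalOrder
  let g : (subst M.arrangement (M.wordProblem q)).lt ↪r (M.arrangement q).lt :=
    RelEmbedding.ofMonotone (fun x => ⟨f x, hf x⟩) hmono
  have hg : Function.Surjective g := by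
    rintro ⟨w, hw⟩
    obtain ⟨x, rfl⟩ := hsurj w hw
    exact ⟨x, rfl⟩
  refine ⟨⟨(RelIso.ofSurjective g hg).symm, fun _ => rfl⟩, fun y => ?_⟩
  obtain ⟨x, rfl⟩ := (RelIso.ofSurjective g hg).surjective y
  change evalRank _ _ ((RelIso.ofSurjective g hg).symm _).2 < (f x).length + 1
  rw [RelIso.symm_apply_apply]
  obtain ⟨i, x⟩ := x
  change evalRank _ _ x < (tagWord (tag i) (M.entryWord _ x)).length + 1
  revert x
  cases hc : (M.wordProblem q).get i with
  | inl g => exact fun x => Nat.succ_pos _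
  | inr p =>
    intro x
    obtain ⟨c, htag, -⟩ := hr i p hc
    rw [htag]
    exact Nat.lt_succ_self _

theorem exists_isUniversal : ∃ S : WordProblem.Solution M.wordProblem,
    S.IsUniversal ∧ S.arr = M.arrangement := by
  choose e he using M.exists_subst_iso
  exact ⟨⟨M.arrangement, e⟩, WordProblem.Solution.isUniversal_of_rank _ _ he, rfl⟩

end PartialDFA

/-! ## Change of universe -/

/-- Sets of words live in the lowest universe, whereas arrangements live in that of the states. Each
closure operation commutes with lifting up to isomorphism. -/
theorem IsFiniteDescription.ulift {α : Type} {r : α → α → Prop} (h : IsFiniteDescription r) :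
    IsFiniteDescription (fun x y : ULift.{u} α => r x.down y.down) := by
  have e : ∀ {α : Type} (r : α → α → Prop),
      Nonempty ((fun x y : ULift.{u} α => r x.down y.down) ≃r r) :=
    fun r => ⟨RelIso.preimage Equiv.ulift r⟩
  have key : ∀ {α : Type} (r : α → α → Prop) {β : Type u} {s : β → β → Prop},
      s ≃r r → IsFiniteDescription s →
        IsFiniteDescription (fun x y : ULift.{u} α => r x.down y.down) :=
    fun r _ _ f hs => hs.iso (f.trans (e r).some.symm)
  induction h with
  | zero => exact key _ ⟨Equiv.equivOfIsEmpty _ _, fun {a} => a.elim⟩ .zero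
  | one => exact key _ ⟨Equiv.ofUnique _ _, Iff.rfl⟩ .one
  | add _ _ h1 h2 => exact key _ (RelIso.sumLexCongr (e _).some (e _).some) (h1.add h2)
  | mulOmega _ h => exact key _ (RelIso.prodLexCongr (RelIso.refl _) (e _).some) h.mulOmega
  | mulOmegaStar _ h =>
    exact key _ (RelIso.prodLexCongr (RelIso.refl _) (e _).some) h.mulOmegaStar
  | shuffle χ hχ _ h =>
    refine key _ ⟨Equiv.sigmaCongrRight fun q => Equiv.ulift, ?_⟩ (IsFiniteDescription.shuffle χ hχ h)
    rintro ⟨p, x⟩ ⟨q, y⟩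
    constructor
    · rintro (⟨_, _, h⟩ | ⟨_, _, h⟩)
      · exact Sigma.Lex.left _ _ h
      · exact Sigma.Lex.right _ _ h
    · rintro (⟨_, _, h⟩ | ⟨_, _, h⟩)
      · exact Sigma.Lex.left _ _ h
      · exact Sigma.Lex.right _ _ h
  | iso f _ h => exact key _ ((e _).some.trans f) h

theorem PartialDFA.isFiniteDescription_arrangement (M : PartialDFA.{u} Bool) (q : M.State) :
    IsFiniteDescription (M.arrangement q).lt :=
  IsFiniteDescription.ulift (M.finiteDescriptionOn_languageFrom q)

/-! ## Strings and the automaton of a hammock -/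

namespace StringAlgebra

open PreWalk

variable {V E : Type u} {Λ : StringAlgebra V E}

namespace Syllable

theorem inv_inv (α : Syllable E) : α.inv.inv = α := by cases α <;> rfl

theorem s_inv (α : Syllable E) : α.inv.s Λ = α.t Λ := by cases α <;> rfl

theorem t_inv (α : Syllable E) : α.inv.t Λ = α.s Λ := by cases α <;> rfl

theorem σ_inv (ε : Λ.Signs) (α : Syllable E) : α.inv.σ ε = α.τ ε := by cases α <;> rfl

end Syllable

namespace PreWalk

/-! ### Extending a string by one syllable -/

theorem IsString.of_infix {x y : PreWalk V E} (hx : x.IsString Λ) (h : y.toList <:+: x.toList) :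
    y.IsString Λ where
  isWalk := hx.isWalk.infix h
  no_rel p hp hy := hx.no_rel p hp (hy.trans h)
  no_inv_rel p hp hy := hx.no_inv_rel p hp (hy.trans h)
  reduced := hx.reduced.infix h

theorem isString_one (v : V) (i : ℤˣ) : (one v i : PreWalk V E).IsString Λ where
  isWalk := List.isChain_nil
  no_rel p hp h := by
    have h2 := Λ.two_le_length p hp
    have := h.length_le
    simp only [toList, List.length_map, List.length_nil] at this
    omega
  no_inv_rel p hp h := by
    have h2 := Λ.two_le_length p hp
    have := h.length_le
    simp only [toList, List.length_map, List.length_reverse, List.length_nil] at this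
    omega
  reduced := List.isChain_nil

theorem isConcat_syllable_one {ε : Λ.Signs} {β : Syllable E} {v : V} {i : ℤˣ} {z : PreWalk V E} :
    IsConcat ε (word β []) (one v i) z ↔ z = word β [] ∧ β.s Λ = v ∧ β.σ ε = -i := by
  constructor
  · rintro (_ | ⟨_, _, _, h1, h2⟩ | _)
    exact ⟨rfl, h1, h2⟩
  · rintro ⟨rfl, h1, h2⟩
    exact .one_right _ _ _ h1 h2

theorem isConcat_syllable_word {ε : Λ.Signs} {β α : Syllable E} {l : List (Syllable E)}
    {z : PreWalk V E} : IsConcat ε (word β []) (word α l) z ↔ z = word β (α :: l) := by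
  constructor
  · rintro (_ | _ | _)
    rfl
  · rintro rfl
    exact .word _ _ _ _

/-- At most one syllable of a given sign extends a given string to a string. -/
theorem syllable_unique {ε : Λ.Signs} {x z z' : PreWalk V E} {β β' : Syllable E}
    (hz : z.IsString Λ) (hz' : z'.IsString Λ) (h : IsConcat ε (word β []) x z)
    (h' : IsConcat ε (word β' []) x z') (hsgn : β.sgn = β'.sgn) : β = β' := by
  -- Needed when the new syllable and its neighbour have opposite signs: reducedness excludes the
  -- neighbour's arrow, so at most one of the two arrows at the vertex remains.
  have two : ∀ {S : Set E}, S.encard ≤ 2 → ∀ {a b c : E}, a ∈ S → b ∈ S → c ∈ S → a ≠ c → b ≠ c →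
      a = b := by
    intro S hS a b c ha hb hc hac hbc
    by_contra hab
    have h3 : ({a, b, c} : Set E).encard ≤ 2 :=
      (Set.encard_le_encard (by rintro _ (rfl | rfl | rfl) <;> assumption)).trans hS
    rw [Set.encard_eq_three.2 ⟨a, b, c, hab, hac, hbc, rfl⟩] at h3
    exact absurd h3 (by decide)
  rcases x with ⟨v, i⟩ | ⟨α, l⟩
  · rw [isConcat_syllable_one] at h h'
    obtain ⟨-, hs, hσ⟩ := h
    obtain ⟨-, hs', hσ'⟩ := h'
    rcases β with b | b <;> rcases β' with b' | b' <;> simp only [Syllable.sgn, reduceCtorEq] at hsgn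
    · by_contra hne
      have := ε.source b b' (fun h => hne (congrArg _ h)) (hs.trans hs'.symm)
      simp only [Syllable.σ] at hσ hσ'
      rw [hσ, hσ'] at this
      exact units_ne_neg_self _ this
    · by_contra hne
      have := ε.target b b' (fun h => hne (congrArg _ h)) (hs.trans hs'.symm)
      simp only [Syllable.σ] at hσ hσ'
      rw [hσ, hσ'] at this
      exact units_ne_neg_self _ this
  · rw [isConcat_syllable_word] at h h'
    subst h h'
    have hw := (List.isChain_cons_cons.1 hz.isWalk).1
    have hw' := (List.isChain_cons_cons.1 hz'.isWalk).1
    have hr := (List.isChain_cons_cons.1 hz.reduced).1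
    have hr' := (List.isChain_cons_cons.1 hz'.reduced).1
    rcases β with b | b <;> rcases β' with b' | b' <;>
      simp only [Syllable.sgn, reduceCtorEq] at hsgn <;> congr 1 <;> rcases α with a | a <;>
      simp only [Syllable.s, Syllable.t, Syllable.inv, ne_eq, Syllable.direct.injEq,
        Syllable.inverse.injEq] at hw hw' hr hr'
    · refine Λ.left_unique a b b' hw hw' (fun h => hz.no_rel _ h ?_) fun h => hz'.no_rel _ h ?_
      · exact ⟨[], l, rfl⟩
      · exact ⟨[], l, rfl⟩
    · exact two (Λ.encard_source_le (Λ.s a)) hw hw' rfl hr hr'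
    · exact two (Λ.encard_target_le (Λ.t a)) hw hw' rfl hr hr'
    · refine Λ.right_unique a b b' hw.symm hw'.symm (fun h => hz.no_inv_rel _ h ?_)
        fun h => hz'.no_inv_rel _ h ?_
      · exact ⟨[], l, rfl⟩
      · exact ⟨[], l, rfl⟩

theorem isConcat_syllable_unique {ε : Λ.Signs} {x z z' : PreWalk V E} {β : Syllable E}
    (h : IsConcat ε (word β []) x z) (h' : IsConcat ε (word β []) x z') : z = z' := by
  rcases x with ⟨v, i⟩ | ⟨α, l⟩
  · rw [isConcat_syllable_one] at h h'
    rw [h.1, h'.1]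
  · rw [isConcat_syllable_word] at h h'
    rw [h, h']

/-- The truncation of an extended string keeps one syllable fewer of the original string than the
truncation of that string does. -/
theorem truncate_word_cons (β α : Syllable E) (l : List (Syllable E)) :
    (word β (α :: l.take (Λ.maxRelLength - 2)) : PreWalk V E).truncate Λ =
      (word β (α :: l)).truncate Λ := by
  simp only [truncate]
  cases Λ.maxRelLength - 2 with
  | zero => rfl
  | succ k => simp [List.take_take]

/-- Whether a syllable can be prepended to a string depends only on the longest short left factor
of the string. -/
theorem isString_word_cons_iff {β α : Syllable E} {l : List (Syllable E)}
    (hx : (word α l : PreWalk V E).IsString Λ) :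
    (word β (α :: l) : PreWalk V E).IsString Λ ↔
      (word β (α :: l.take (Λ.maxRelLength - 2)) : PreWalk V E).IsString Λ := by
  have hpre : β :: α :: l.take (Λ.maxRelLength - 2) <+: β :: α :: l := by
    simpa using List.take_prefix _ _
  refine ⟨fun h => h.of_infix hpre.isInfix, fun h => ?_⟩
  have h2 : 2 ≤ Λ.maxRelLength := le_max_left _ _
  -- A relation that meets `β` is a left factor of at most maximal length, hence uses only syllables
  -- kept by the truncation.
  have hpre' : ∀ m : List (Syllable E), m.length ≤ Λ.maxRelLength → m <+: β :: α :: l →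
      m <:+: β :: α :: l.take (Λ.maxRelLength - 2) := by
    intro m hm hml
    refine (List.prefix_of_prefix_length_le hml hpre ?_).isInfix
    have := hml.length_le
    simp only [List.length_cons, List.length_take] at this ⊢
    omega
  have hlen : ∀ p ∈ Λ.rel, p.length ≤ Λ.maxRelLength := fun p hp =>
    (Finset.le_sup (f := List.length) hp).trans (le_max_right _ _)
  refine ⟨?_, fun p hp hq => ?_, fun p hp hq => ?_, ?_⟩
  · exact List.isChain_cons_cons.2 ⟨(List.isChain_cons_cons.1 h.isWalk).1, hx.isWalk⟩
  · rcases List.infix_cons_iff.1 hq with hq | hq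
    · exact h.no_rel p hp (hpre' _ (by simpa using hlen p hp) hq)
    · exact hx.no_rel p hp hq
  · rcases List.infix_cons_iff.1 hq with hq | hq
    · exact h.no_inv_rel p hp (hpre' _ (by simpa using hlen p hp) hq)
    · exact hx.no_inv_rel p hp hq
  · exact List.isChain_cons_cons.2 ⟨(List.isChain_cons_cons.1 h.reduced).1, hx.reduced⟩

/-- With its converse `exists_isExtension_of_truncate`, this shows that remembering only the
truncation loses no information about extensions or about the truncations of the results. -/
theorem exists_isExtension_truncate {ε : Λ.Signs} {x z : PreWalk V E} {c : Bool}
    (h : IsExtension ε x c z) :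
    ∃ z', IsExtension ε (x.truncate Λ) c z' ∧ z'.truncate Λ = z.truncate Λ := by
  obtain ⟨hz, β, hβ, h⟩ := h
  rcases x with ⟨v, i⟩ | ⟨α, l⟩
  · exact ⟨z, ⟨hz, β, hβ, h⟩, rfl⟩
  · rw [isConcat_syllable_word] at h
    subst h
    have hx := hz.of_infix (y := word α l) (List.suffix_cons _ _).isInfix
    exact ⟨_, ⟨(isString_word_cons_iff hx).1 hz, β, hβ, isConcat_syllable_word.2 rfl⟩,
      truncate_word_cons β α l⟩

theorem exists_isExtension_of_truncate {ε : Λ.Signs} {x z' : PreWalk V E} {c : Bool}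
    (hx : x.IsString Λ) (h : IsExtension ε (x.truncate Λ) c z') :
    ∃ z, IsExtension ε x c z ∧ z.truncate Λ = z'.truncate Λ := by
  obtain ⟨hz, β, hβ, h⟩ := h
  rcases x with ⟨v, i⟩ | ⟨α, l⟩
  · exact ⟨z', ⟨hz, β, hβ, h⟩, rfl⟩
  · simp only [truncate] at h
    rw [isConcat_syllable_word] at h
    subst h
    exact ⟨_, ⟨(isString_word_cons_iff hx).2 hz, β, hβ, isConcat_syllable_word.2 rfl⟩,
      (truncate_word_cons β α l).symm⟩

/-- The walk with a given list of syllables, which is `1_(v,i)` for the empty list. -/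
def ofList (v : V) (i : ℤˣ) : List (Syllable E) → PreWalk V E
  | [] => one v i
  | α :: l => word α l

theorem toList_ofList (v : V) (i : ℤˣ) (l : List (Syllable E)) : (ofList v i l).toList = l := by
  cases l <;> rfl

theorem IsConcat.toList_eq {ε : Λ.Signs} {β : Syllable E} {x z : PreWalk V E}
    (h : IsConcat ε (PreWalk.word β []) x z) : z.toList = β :: x.toList := by
  rcases x with ⟨v, i⟩ | ⟨α, l⟩
  · rw [isConcat_syllable_one] at h
    rw [h.1]
    rfl
  · rw [isConcat_syllable_word] at h
    rw [h]
    rfl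

end PreWalk

/-- The strings `x` such that `x 1_(v,i)` is defined. -/
def stringsAt (ε : Λ.Signs) (v : V) (i : ℤˣ) : Set (PreWalk V E) :=
  {x | x.IsString Λ ∧ IsConcat ε x (one v i) x}

section StringsAt

variable {ε : Λ.Signs} {v : V} {i : ℤˣ}

theorem one_mem_stringsAt : one v i ∈ stringsAt ε v i :=
  ⟨isString_one v i, .one_left _ _ _ rfl rfl⟩

/-- Only the zero-length string needs an argument: its vertex and sign are forced by the prescribed
right end. Strings can therefore be handled as lists of syllables. -/
theorem eq_ofList {x : PreWalk V E} (hx : x ∈ stringsAt ε v i) : x = ofList v i x.toList := by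
  obtain ⟨-, hx⟩ := hx
  rcases x with ⟨v', j⟩ | ⟨α, l⟩
  · rcases hx with ⟨_, _, _, h1, h2⟩ | ⟨_, _, _, h1, h2⟩
    · rfl
    · simp only [σ, neg_inj] at h1 h2
      subst h1 h2
      rfl
  · rfl

theorem word_mem_stringsAt {α : Syllable E} {l : List (Syllable E)} :
    word α l ∈ stringsAt ε v i ↔ (word α l).IsString Λ ∧ (word α l).s Λ = v ∧
      (word α l).σ ε = -i := by
  constructor
  · rintro ⟨h, _ | ⟨_, _, _, h1, h2⟩ | _⟩
    exact ⟨h, h1, h2⟩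
  · rintro ⟨h, h1, h2⟩
    exact ⟨h, .one_right _ _ _ h1 h2⟩

theorem ofList_cons_mem_stringsAt {β : Syllable E} {l : List (Syllable E)} :
    ofList v i (β :: l) ∈ stringsAt ε v i ↔ ofList v i l ∈ stringsAt ε v i ∧
      (word β l : PreWalk V E).IsString Λ ∧
      IsConcat ε (word β []) (ofList v i l) (ofList v i (β :: l)) := by
  rcases l with _ | ⟨α, l⟩
  · change word β [] ∈ _ ↔ one v i ∈ _ ∧ _ ∧ IsConcat ε _ (one v i) (word β [])
    rw [word_mem_stringsAt, isConcat_syllable_one]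
    simp [one_mem_stringsAt, PreWalk.s, σ]
  · change word β (α :: l) ∈ _ ↔ word α l ∈ _ ∧ _ ∧
      IsConcat ε _ (word α l) (word β (α :: l))
    rw [word_mem_stringsAt, word_mem_stringsAt, isConcat_syllable_word]
    constructor
    · rintro ⟨h, h1, h2⟩
      exact ⟨⟨h.of_infix (List.suffix_cons _ _).isInfix, h1, h2⟩, h, rfl⟩
    · rintro ⟨⟨-, h1, h2⟩, h, -⟩
      exact ⟨h, h1, h2⟩

theorem mem_stringsAt_of_isConcat {β : Syllable E} {x z : PreWalk V E}
    (hx : x ∈ stringsAt ε v i) (hz : z.IsString Λ) (h : IsConcat ε (word β []) x z) :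
    z ∈ stringsAt ε v i := by
  rw [eq_ofList hx] at h hx
  have hz' : z = ofList v i (β :: x.toList) := by
    generalize x.toList = l at h
    rcases l with _ | ⟨α, l⟩
    · exact (isConcat_syllable_one.1 h).1
    · exact isConcat_syllable_word.1 h
  subst hz'
  exact ofList_cons_mem_stringsAt.2 ⟨hx, hz, h⟩

theorem ofList_mem_stringsAt_of_append {l m : List (Syllable E)}
    (h : ofList v i (l ++ m) ∈ stringsAt ε v i) : ofList v i m ∈ stringsAt ε v i := by
  induction l with
  | nil => exact h
  | cons β l ih => exact ih (ofList_cons_mem_stringsAt.1 h).1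

theorem syllable_eq_of_sgn_eq {β β' : Syllable E} {l l' m : List (Syllable E)}
    (h : ofList v i (l ++ [β] ++ m) ∈ stringsAt ε v i)
    (h' : ofList v i (l' ++ [β'] ++ m) ∈ stringsAt ε v i) (hsgn : β.sgn = β'.sgn) : β = β' := by
  rw [List.append_assoc] at h h'
  have h1 := ofList_cons_mem_stringsAt.1 (ofList_mem_stringsAt_of_append h)
  have h2 := ofList_cons_mem_stringsAt.1 (ofList_mem_stringsAt_of_append h')
  exact syllable_unique h1.2.1 h2.2.1 h1.2.2 h2.2.2 hsgn

/-- The signs of a list of syllables, read from right to left. -/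
def sgnList (l : List (Syllable E)) : List Bool := (l.map Syllable.sgn).reverse

theorem sgnList_append (l m : List (Syllable E)) :
    sgnList (l ++ m) = sgnList m ++ sgnList l := by
  simp [sgnList]

theorem head?_sgnList (l : List (Syllable E)) :
    (sgnList l).head? = l.getLast?.map Syllable.sgn := by
  simp [sgnList]

/-- A string is recovered from its signs one syllable at a time from the right, each one forced by
`syllable_unique`. -/
theorem sgn_injOn : Set.InjOn (PreWalk.sgn (V := V) (E := E)) (stringsAt ε v i) := by
  have key : ∀ l l' : List (Syllable E), ofList v i l ∈ stringsAt ε v i →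
      ofList v i l' ∈ stringsAt ε v i → sgnList l = sgnList l' → l = l' := by
    intro l
    induction l with
    | nil =>
      rintro (_ | ⟨β, l'⟩) _ _ h
      · rfl
      · simp [sgnList] at h
    | cons α l ih =>
      rintro (_ | ⟨β, l'⟩) hx hy h
      · simp [sgnList] at h
      · simp only [sgnList, List.map_cons, List.reverse_cons] at h
        obtain ⟨h1, h2⟩ := List.append_inj' h rfl
        have hx' := ofList_cons_mem_stringsAt.1 hx
        have hy' := ofList_cons_mem_stringsAt.1 hy
        obtain rfl := ih l' hx'.1 hy'.1 h1
        rw [syllable_unique hx'.2.1 hy'.2.1 hx'.2.2 hy'.2.2 (List.singleton_inj.1 h2)]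
  intro x hx y hy h
  rw [eq_ofList hx, eq_ofList hy,
    key x.toList y.toList (eq_ofList hx ▸ hx) (eq_ofList hy ▸ hy) h]

/-- Since equal signs after a common right factor mean equal syllables, the longest common right
factor of two strings corresponds to the longest common prefix of their sign words. -/
theorem ltL_iff {x y : PreWalk V E} (hx : x ∈ stringsAt ε v i) (hy : y ∈ stringsAt ε v i) :
    x.LtL y ↔ inorderVal x.sgn < inorderVal y.sgn := by
  rw [eq_ofList hx] at hx
  rw [eq_ofList hy] at hy
  change _ ↔ inorderVal (sgnList x.toList) < inorderVal (sgnList y.toList)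
  unfold LtL
  generalize x.toList = l at *
  generalize y.toList = m at *
  constructor
  · rintro ⟨w, l', m', rfl, rfl, hw, h⟩
    rw [sgnList_append, sgnList_append, inorderVal_append_lt_append]
    refine inorderVal_lt_of_head (fun he => ?_) ?_
    · rw [head?_sgnList, head?_sgnList] at he
      rw [head?_sgnList]
      rcases List.eq_nil_or_concat' l' with rfl | ⟨l', α, rfl⟩
      · rfl
      · rcases List.eq_nil_or_concat' m' with rfl | ⟨m', β, rfl⟩
        · simp at he
        · have : α = β := syllable_eq_of_sgn_eq hx hy (by simpa using he)
          subst this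
          have := hw (α :: w) ⟨l', by simp⟩ ⟨m', by simp⟩
          simp at this
    · rw [head?_sgnList, head?_sgnList]
      rcases h with ⟨a, ha⟩ | ⟨a, ha⟩
      · exact Or.inl (by rw [ha]; rfl)
      · exact Or.inr (by rw [ha]; rfl)
  · intro h
    obtain ⟨w, l', m', hl, hm, -, hw⟩ := exists_longest_common_prefix l.reverse m.reverse
    have hl' : l = l'.reverse ++ w.reverse := by
      rw [← List.reverse_append, ← hl, List.reverse_reverse]
    have hm' : m = m'.reverse ++ w.reverse := by
      rw [← List.reverse_append, ← hm, List.reverse_reverse]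
    refine ⟨w.reverse, l'.reverse, m'.reverse, hl', hm', fun u hu hu' => ?_, ?_⟩
    · simpa using hw u.reverse (List.reverse_prefix.2 hu) (List.reverse_prefix.2 hu')
    · rw [hl', hm', sgnList_append, sgnList_append, inorderVal_append_lt_append] at h
      have hc : ∀ (k : List (Syllable E)) (c : Bool), (sgnList k).head? = some c →
          ∃ β, k.getLast? = some β ∧ β.sgn = c := by
        intro k c hk
        rw [head?_sgnList] at hk
        simpa using hk
      rcases head_of_inorderVal_lt h with h | h
      · obtain ⟨β | β, h1, h2⟩ := hc _ _ h
        · exact Or.inl ⟨β, h1⟩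
        · simp [Syllable.sgn] at h2
      · obtain ⟨β | β, h1, h2⟩ := hc _ _ h
        · simp [Syllable.sgn] at h2
        · exact Or.inr ⟨β, h1⟩

/-! ### Runs of the hammock automaton -/

variable [Finite V] [Finite E]

theorem automaton_step_eq_some (v : V) {x y : Λ.Short} {c : Bool} :
    (automaton ε v).step x c = some y ↔ ∃ z, IsExtension ε x.1 c z ∧ y.1 = z.truncate Λ := by
  have hu : ∀ z z', IsExtension ε x.1 c z → IsExtension ε x.1 c z' → z = z' := by
    rintro z z' ⟨hz, β, hβ, h⟩ ⟨hz', β', hβ', h'⟩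
    obtain rfl := syllable_unique hz hz' h h' (hβ.trans hβ'.symm)
    exact isConcat_syllable_unique h h'
  classical
  change (if h : ∃ z, IsExtension ε x.1 c z then
    some (toShort h.choose h.choose_spec.1) else none) = some y ↔ _
  split_ifs with h
  · rw [Option.some.injEq]
    constructor
    · rintro rfl
      exact ⟨_, h.choose_spec, rfl⟩
    · rintro ⟨z, hz, hy⟩
      refine Subtype.ext ?_
      rw [hy, hu z _ hz h.choose_spec]
      rfl
  · simp only [false_iff]
    rintro ⟨z, hz, -⟩
    exact h ⟨z, hz⟩

/-- The invariant of a run: the current state is the truncation of the string whose sign word has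
been read. Transitions do not depend on the start vertex `v'`, so the run may begin at any
zero-length string, including the one needed for right hammocks. -/
theorem automaton_run_eq_some (v' : V) {q₀ q : Λ.Short} (hq₀ : q₀.1 = one v i) {w : List Bool} :
    (automaton ε v').run q₀ w = some q ↔
      ∃ x ∈ stringsAt ε v i, x.sgn = w ∧ q.1 = x.truncate Λ := by
  induction w using List.reverseRecOn generalizing q with
  | nil =>
    constructor
    · intro h
      obtain rfl : q₀ = q := Option.some_injective _ h
      exact ⟨one v i, one_mem_stringsAt, rfl, hq₀⟩
    · rintro ⟨x, hx, hsgn, hq⟩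
      obtain rfl : x = one v i := sgn_injOn hx one_mem_stringsAt hsgn
      exact congrArg some (Subtype.ext (hq₀.trans hq.symm))
  | append_singleton w c ih =>
    refine (Iff.of_eq (congrArg (· = some q) (PartialDFA.run_append _ _ _ _))).trans
      (Option.bind_eq_some_iff.trans ?_)
    have hsingle : ∀ p q : Λ.Short, (automaton ε v').run p [c] = some q ↔
        ∃ z, IsExtension ε p.1 c z ∧ q.1 = z.truncate Λ := fun p q => by
      rw [← automaton_step_eq_some v']
      exact Iff.of_eq (congrArg (· = some q) (by simp [PartialDFA.run]; rfl))
    constructor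
    · rintro ⟨p, hp, hq⟩
      obtain ⟨x, hx, rfl, hpx⟩ := ih.1 hp
      obtain ⟨z', hz', hqz⟩ := (hsingle p q).1 hq
      rw [hpx] at hz'
      obtain ⟨z, ⟨hz, β, rfl, hβ⟩, hzz'⟩ := exists_isExtension_of_truncate hx.1 hz'
      refine ⟨z, mem_stringsAt_of_isConcat hx hz hβ, ?_, hqz.trans hzz'.symm⟩
      simp [sgn, hβ.toList_eq]
    · rintro ⟨z, hz, hsgn, hq⟩
      have hzl := eq_ofList hz
      rcases hl : z.toList with _ | ⟨β, l⟩
      · simp [sgn, hl] at hsgn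
      · rw [hl] at hzl
        rw [hzl, ofList_cons_mem_stringsAt] at hz
        simp only [sgn, hl, List.map_cons, List.reverse_cons] at hsgn
        obtain ⟨h1, h2⟩ := List.append_inj' hsgn rfl
        have hzs : z.IsString Λ := hzl ▸ hz.2.1
        refine ⟨toShort (ofList v i l) hz.1.1,
          ih.2 ⟨_, hz.1, by rw [sgn, toList_ofList]; exact h1, rfl⟩,
          (hsingle _ _).2 ?_⟩
        obtain ⟨z', hz', h⟩ := exists_isExtension_truncate (ε := ε) (x := ofList v i l) (z := z)
          (c := c) ⟨hzs, β, List.singleton_inj.1 h2, hzl ▸ hz.2.2⟩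
        exact ⟨z', hz', hq.trans h.symm⟩

/-- The sign sequence is an order isomorphism from the strings starting at `1_(v,i)` onto the
words accepted by the automaton from that state. -/
theorem exists_stringsAt_relIso (v' : V) {q₀ : Λ.Short} (hq₀ : q₀.1 = one v i) :
    ∃ e : (fun x y : stringsAt ε v i => x.1.LtL y.1) ≃r
        InorderOn ((automaton ε v').languageFrom q₀), ∀ x, (e x).1 = x.1.sgn := by
  have hmem : ∀ x : stringsAt ε v i, x.1.sgn ∈ (automaton ε v').languageFrom q₀ := fun x =>
    ⟨toShort x.1 x.2.1, trivial, (automaton_run_eq_some v' hq₀).2 ⟨x, x.2, rfl, rfl⟩⟩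
  refine ⟨⟨Equiv.ofBijective (fun x => ⟨x.1.sgn, hmem x⟩) ⟨?_, ?_⟩, ?_⟩, fun _ => rfl⟩
  · intro x y h
    exact Subtype.ext (sgn_injOn x.2 y.2 (congrArg Subtype.val h))
  · rintro ⟨w, q, -, hw⟩
    obtain ⟨x, hx, rfl, -⟩ := (automaton_run_eq_some v' hq₀).1 hw
    exact ⟨⟨x, hx⟩, rfl⟩
  · intro x y
    exact (ltL_iff x.2 y.2).symm

theorem isStrictTotalOrder_stringsAt :
    IsStrictTotalOrder (stringsAt ε v i) (fun x y => x.1.LtL y.1) := by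
  obtain ⟨e, -⟩ := exists_stringsAt_relIso (ε := ε) v (q₀ := toShort (one v i) (isString_one v i)) rfl
  exact e.toRelEmbedding.isStrictTotalOrder

theorem isFiniteDescription_stringsAt :
    IsFiniteDescription (fun x y : stringsAt ε v i => x.1.LtL y.1) := by
  obtain ⟨e, -⟩ := exists_stringsAt_relIso (ε := ε) v (q₀ := toShort (one v i) (isString_one v i)) rfl
  exact ((automaton ε v).isFiniteDescription_arrangement _).iso
    ((RelIso.preimage Equiv.ulift (InorderOn _)).trans e.symm)

end StringsAt

/-! ## Inverse strings and the hammocks -/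

namespace PreWalk

theorem toList_inv (x : PreWalk V E) : x.inv.toList = (x.toList.map Syllable.inv).reverse := by
  cases x with
  | one v i => rfl
  | word α l => exact List.cons_head_tail _

theorem eq_of_toList_eq {α : Syllable E} {l : List (Syllable E)} {x : PreWalk V E}
    (h : x.toList = α :: l) : x = word α l := by
  cases x with
  | one v i => simp [toList] at h
  | word β m =>
    simp only [toList, List.cons.injEq] at h
    rw [h.1, h.2]

theorem inv_inv (x : PreWalk V E) : x.inv.inv = x := by
  cases x with
  | one v i => simp [inv]
  | word α l =>
    refine eq_of_toList_eq ?_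
    rw [toList_inv, toList_inv]
    simp [toList, Function.comp_def, Syllable.inv_inv]

theorem s_of_toList_eq {α : Syllable E} {l : List (Syllable E)} {x : PreWalk V E}
    (h : x.toList = l ++ [α]) : x.s Λ = α.s Λ := by
  cases x with
  | one v i => simp [toList] at h
  | word β m =>
    simp only [toList] at h
    simp [s, h]

theorem σ_of_toList_eq (ε : Λ.Signs) {α : Syllable E} {l : List (Syllable E)} {x : PreWalk V E}
    (h : x.toList = l ++ [α]) : x.σ ε = α.σ ε := by
  cases x with
  | one v i => simp [toList] at h
  | word β m =>
    simp only [toList] at h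
    simp [σ, h]

theorem toList_inv_word (α : Syllable E) (l : List (Syllable E)) :
    (word α l : PreWalk V E).inv.toList = (l.map Syllable.inv).reverse ++ [α.inv] := by
  rw [toList_inv]
  simp [toList]

theorem s_inv (x : PreWalk V E) : x.inv.s Λ = x.t Λ := by
  cases x with
  | one v i => rfl
  | word α l => exact (s_of_toList_eq (toList_inv_word α l)).trans (Syllable.s_inv α)

theorem σ_inv (ε : Λ.Signs) (x : PreWalk V E) : x.inv.σ ε = x.τ ε := by
  cases x with
  | one v i => simp [inv, σ, τ]
  | word α l => exact (σ_of_toList_eq ε (toList_inv_word α l)).trans (Syllable.σ_inv ε α)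

theorem IsString.inv {x : PreWalk V E} (h : x.IsString Λ) : x.inv.IsString Λ := by
  have hinf : ∀ m : List (Syllable E), m <:+: x.inv.toList →
      (m.map Syllable.inv).reverse <:+: x.toList := by
    intro m hm
    have := List.reverse_infix.2 (hm.map Syllable.inv)
    rw [toList_inv] at this
    simpa [Function.comp_def, Syllable.inv_inv] using this
  refine ⟨?_, fun p hp hq => h.no_inv_rel p hp ?_, fun p hp hq => h.no_rel p hp ?_, ?_⟩
  · rw [IsWalk, toList_inv, List.isChain_reverse, List.isChain_map]
    refine h.isWalk.imp fun α β hαβ => ?_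
    simpa only [flip, Syllable.s_inv, Syllable.t_inv] using hαβ.symm
  · simpa [Function.comp_def, Syllable.inv] using hinf _ hq
  · simpa [Function.comp_def, Syllable.inv] using hinf _ hq
  · rw [toList_inv, List.isChain_reverse, List.isChain_map]
    refine h.reduced.imp fun α β hαβ h' => hαβ ?_
    simp only [Syllable.inv_inv] at h'
    exact h'.symm

end PreWalk

/-- The zero-length string is always an admissible right partner, so membership in the projection
imposes no further condition. -/
theorem hammockL_eq (ε : Λ.Signs) (v : V) : hammockL ε v = stringsAt ε v 1 := by
  ext x
  constructor
  · rintro ⟨⟨x, y⟩, ⟨h1, -, h2, -⟩, rfl⟩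
    exact ⟨h1, h2⟩
  · rintro ⟨h1, h2⟩
    exact ⟨(x, one v 1), ⟨h1, isString_one v 1, h2, .one_left _ _ _ rfl rfl, x, h2, h1⟩, rfl⟩

theorem mem_hammockR {ε : Λ.Signs} {v : V} {x : PreWalk V E} :
    x ∈ hammockR ε v ↔ x.IsString Λ ∧ x.t Λ = v ∧ x.τ ε = 1 := by
  constructor
  · rintro ⟨⟨y, x⟩, ⟨-, h1, -, h2, -⟩, rfl⟩
    refine ⟨h1, ?_⟩
    rcases h2 with ⟨_, _, _, h2, h3⟩ | _
    · exact ⟨h2, h3⟩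
    · exact ⟨rfl, rfl⟩
  · rintro ⟨h1, h2, h3⟩
    exact ⟨(one v 1, x), ⟨isString_one v 1, h1, .one_left _ _ _ rfl rfl, .one_left _ _ _ h2 h3, x,
      .one_left _ _ _ h2 h3, h1⟩, rfl⟩

/-- Inversion turns target and `τ` into source and `σ`. The sign changes to `-1` because a product
with `1_(v,i)` on the right requires `σ = -i`. -/
theorem inv_mem_stringsAt_iff {ε : Λ.Signs} {v : V} {x : PreWalk V E} :
    x.inv ∈ stringsAt ε v (-1) ↔ x ∈ hammockR ε v := by
  rw [mem_hammockR]
  constructor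
  · intro h
    refine ⟨x.inv_inv ▸ h.1.inv, ?_⟩
    rw [← s_inv, ← σ_inv]
    cases hx : x.inv with
    | one v' j =>
      rw [hx] at h
      have := eq_ofList h
      simp only [toList, ofList] at this
      injection this with h1 h2
      subst h1 h2
      simp [PreWalk.s, σ]
    | word α l =>
      rw [hx, word_mem_stringsAt, neg_neg] at h
      exact h.2
  · rintro ⟨h1, h2, h3⟩
    refine ⟨h1.inv, .one_right _ _ _ ((s_inv x).trans h2) ?_⟩
    rw [σ_inv, h3, neg_neg]

/-- Inversion identifies the right hammock at `v` with the strings starting at `1_(v,-1)`. -/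
def hammockR.relIso (ε : Λ.Signs) (v : V) :
    hammockR.lt ε v ≃r (fun x y : stringsAt ε v (-1) => x.1.LtL y.1) where
  toFun x := ⟨x.1.inv, inv_mem_stringsAt_iff.2 x.2⟩
  invFun x := ⟨x.1.inv, inv_mem_stringsAt_iff.1 (x.1.inv_inv.symm ▸ x.2)⟩
  left_inv x := Subtype.ext x.1.inv_inv
  right_inv x := Subtype.ext x.1.inv_inv
  map_rel_iff' := Iff.rfl

/-- The left hammock at `v` consists of the strings starting at `1_(v,1)`. -/
def hammockL.relIso (ε : Λ.Signs) (v : V) :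
    hammockL.lt ε v ≃r (fun x y : stringsAt ε v 1 => x.1.LtL y.1) where
  toEquiv := Equiv.setCongr (hammockL_eq ε v)
  map_rel_iff' := Iff.rfl

end StringAlgebra

/-- The linguage of an automaton consists of the words accepted from the start state. -/
def PartialDFA.linguageRelIso (M : PartialDFA.{u} Bool) :
    InorderOn (M.languageFrom M.start) ≃r M.linguage where
  toEquiv := Equiv.refl _
  map_rel_iff' := inorder_iff

theorem mainTheorem1 {V E : Type u} [Finite V] [Finite E] (Λ : StringAlgebra V E)
    (ε : Λ.Signs) (v : V) :
    -- the hammocks are linear orders, and they are finite description linear orders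
    (IsStrictTotalOrder (StringAlgebra.hammockL ε v) (StringAlgebra.hammockL.lt ε v) ∧
      IsFiniteDescription (StringAlgebra.hammockL.lt ε v)) ∧
    (IsStrictTotalOrder (StringAlgebra.hammockR ε v) (StringAlgebra.hammockR.lt ε v) ∧
      IsFiniteDescription (StringAlgebra.hammockR.lt ε v)) ∧
    -- the sign sequence is an isomorphism from the left hammock to the linguage of the automaton
    (∃ e : StringAlgebra.hammockL.lt ε v ≃r (StringAlgebra.automaton ε v).linguage,
      ∀ x, (e x : List Bool) = (x : StringAlgebra.PreWalk V E).sgn) ∧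
    -- the word problem of the automaton has a universal solution, whose component at the start
    -- state is the linguage and whose components are finite description linear orders
    (∃ S : WordProblem.Solution (StringAlgebra.automaton ε v).wordProblem, S.IsUniversal) ∧
    (∀ S : WordProblem.Solution (StringAlgebra.automaton ε v).wordProblem, S.IsUniversal →
      Nonempty ((S.arr (StringAlgebra.automaton ε v).start).lt ≃r
        (StringAlgebra.automaton ε v).linguage) ∧
      ∀ q, IsFiniteDescription (S.arr q).lt) := by
  set M := StringAlgebra.automaton ε v
  obtain ⟨S₀, hS₀, hS₀arr⟩ := M.exists_isUniversal
  obtain ⟨e, he⟩ := StringAlgebra.exists_stringsAt_relIso (ε := ε) (i := 1) v (q₀ := M.start) rfl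
  refine ⟨⟨?_, ?_⟩, ⟨?_, ?_⟩, ?_, ⟨S₀, hS₀⟩, fun S hS => ⟨?_, fun q => ?_⟩⟩
  · have := StringAlgebra.isStrictTotalOrder_stringsAt (ε := ε) (v := v) (i := 1)
    exact (StringAlgebra.hammockL.relIso ε v).toRelEmbedding.isStrictTotalOrder
  · exact StringAlgebra.isFiniteDescription_stringsAt.iso (StringAlgebra.hammockL.relIso ε v).symm
  · have := StringAlgebra.isStrictTotalOrder_stringsAt (ε := ε) (v := v) (i := -1)
    exact (StringAlgebra.hammockR.relIso ε v).toRelEmbedding.isStrictTotalOrder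
  · exact StringAlgebra.isFiniteDescription_stringsAt.iso (StringAlgebra.hammockR.relIso ε v).symm
  · exact ⟨((StringAlgebra.hammockL.relIso ε v).trans e).trans M.linguageRelIso, fun x => he _⟩
  · obtain ⟨f⟩ := hS.nonempty_relIso hS₀ M.start
    rw [hS₀arr] at f
    exact ⟨(f.trans (RelIso.preimage Equiv.ulift (InorderOn _))).trans M.linguageRelIso⟩
  · obtain ⟨f⟩ := hS.nonempty_relIso hS₀ q
    rw [hS₀arr] at f
    exact (M.isFiniteDescription_arrangement q).iso f.symm
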